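/- Let $(R_1,\mathfrak m_1,\mathsf k)$ and $(R_2,\mathfrak m_2,\mathsf k)$ be Noetherian local rings with common residue field $\mathsf k$, neither of which is a field, and assume both are Koszul, i.e. the residue field $\mathsf k$ has a linear resolution over each standard graded $\mathsf k$-algebra $G_{\mathfrak m_i}(R_i)=\bigoplus_{n\ge 0}\mathfrak m_i^n/\mathfrak m_i^{n+1}$. Let $R=R_1\times_{\mathsf k}R_2=\{(a,b)\in R_1\times R_2 : \pi_1(a)=\pi_2(b)\}$, where $\pi_i:R_i\to\mathsf k$ are the natural projections; this is a local ring, with maximal ideal denoted $\mathfrak m$. Put $A=G_{\mathfrak m}(R)$. Let $M$ be a finitely generated $R$-module, and let $G_{\mathfrak m}(M)=\bigoplus_{n\ge 0}\mathfrak m^nM/\mathfrak m^{n+1}M$. Suppose that the graded $A$-module $G_{\mathfrak m}(M)$ has a pure resolution, i.e. in its minimal graded free resolution over $A$ each free module is generated in a single degree (for every $i$ the graded Betti number $\beta^A_{i,j}(G_{\mathfrak m}(M))$ is nonzero for at most one $j$). Then: 1. The second syzygy module $\Omega_2^A(G_{\mathfrak m}(M))$, that is, the kernel of the map from the first to the zeroth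 free module in a minimal graded free resolution of $G_{\mathfrak m}(M)$ over $A$, has a linear resolution over $A$: there is $\delta_0\in\mathbb Z$ such that $\beta^A_{i,j}(\Omega_2^A(G_{\mathfrak m}(M)))\neq 0$ implies $j=\delta_0+i$. 2. If $\cdots\to F_2\xrightarrow{\phi_2}F_1\xrightarrow{\phi_1}F_0\to 0$ is a minimal free resolution of $M$ over $R$, then for each $j>2$ every column of the matrix of $\phi_j$ (with respect to any bases of $F_j$ and $F_{j-1}$) has order $1$, i.e. lies in $\mathfrak mF_{j-1}\setminus\mathfrak m^2F_{j-1}$. -/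

import Mathlib

open IsLocalRing DirectSum

noncomputable section

/-! ### Associated graded rings and modules -/

section AssociatedGraded

universe u v

variable {R : Type u} [CommRing R] (I : Ideal R) (M : Type v) [AddCommGroup M] [Module R M]

/-- The quotient `I ^ n M / I ^ (n + 1) M`. For `M = R` it is `I ^ n / I ^ (n + 1)`. -/
abbrev GrPiece (n : ℕ) : Type v :=
  ↥(I ^ n • (⊤ : Submodule R M)) ⧸
    (I ^ (n + 1) • (⊤ : Submodule R M)).submoduleOf (I ^ n • (⊤ : Submodule R M))

variable {M}

/-- The class of `x ∈ I ^ n M` modulo `I ^ (n + 1) M`. -/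
def GrPiece.mk {n : ℕ} (x : M) (hx : x ∈ I ^ n • (⊤ : Submodule R M)) : GrPiece I M n :=
  Submodule.Quotient.mk ⟨x, hx⟩

variable {I}

theorem GrPiece.mk_surj {n : ℕ} (y : GrPiece I M n) : ∃ x hx, y = GrPiece.mk I (M := M) x hx := by
  obtain ⟨⟨x, hx⟩, rfl⟩ := Submodule.Quotient.mk_surjective _ y
  exact ⟨x, hx, rfl⟩

theorem GrPiece.smul_mem {i j : ℕ} {a : R} {x : M} (ha : a ∈ I ^ i • (⊤ : Submodule R R))
    (hx : x ∈ I ^ j • (⊤ : Submodule R M)) : a • x ∈ I ^ (i + j) • (⊤ : Submodule R M) := by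
  rw [pow_add, mul_smul]
  exact Submodule.smul_mem_smul (by simpa using ha) hx

theorem GrPiece.one_mem : (1 : R) ∈ I ^ 0 • (⊤ : Submodule R R) := by simp

variable (I M) in
/-- The map `(a, x) ↦ a x + I ^ (i + j + 1) M` on `I ^ i × I ^ j M`. -/
def GrPiece.smulAux (i j : ℕ) : ↥(I ^ i • (⊤ : Submodule R R)) →ₗ[R]
    ↥(I ^ j • (⊤ : Submodule R M)) →ₗ[R] GrPiece I M (i + j) :=
  LinearMap.mk₂ R
    (fun a x => GrPiece.mk I (a.1 • x.1) (GrPiece.smul_mem a.2 x.2))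
    (fun a a' x => congrArg Submodule.Quotient.mk (Subtype.ext (add_smul a.1 a'.1 x.1)))
    (fun c a x => congrArg Submodule.Quotient.mk (Subtype.ext (smul_assoc c a.1 x.1)))
    (fun a x x' => congrArg Submodule.Quotient.mk (Subtype.ext (smul_add a.1 x.1 x'.1)))
    (fun c a x => congrArg Submodule.Quotient.mk (Subtype.ext (smul_comm a.1 c x.1)))

variable (I M) in
/-- The action `(a + I ^ (i + 1)) • (x + I ^ (j + 1) M) = a x + I ^ (i + j + 1) M`. -/
def GrPiece.smul (i j : ℕ) : GrPiece I R i →ₗ[R] GrPiece I M j →ₗ[R] GrPiece I M (i + j) :=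
  Submodule.liftQ _
    (Submodule.liftQ _ (GrPiece.smulAux I M i j).flip (by
      intro x hx
      rw [LinearMap.mem_ker]
      ext a
      refine (Submodule.Quotient.mk_eq_zero _).2 ?_
      change a.1 • x.1 ∈ I ^ (i + j + 1) • (⊤ : Submodule R M)
      rw [add_assoc]
      exact GrPiece.smul_mem a.2 hx)).flip
    (by
      intro a ha
      rw [LinearMap.mem_ker]
      ext x
      refine (Submodule.Quotient.mk_eq_zero _).2 ?_
      change a.1 • x.1 ∈ I ^ (i + j + 1) • (⊤ : Submodule R M)
      rw [add_right_comm]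
      exact GrPiece.smul_mem ha x.2)

theorem GrPiece.smul_mk {i j : ℕ} {a : R} {x : M} (ha : a ∈ I ^ i • (⊤ : Submodule R R))
    (hx : x ∈ I ^ j • (⊤ : Submodule R M)) :
    GrPiece.smul I M i j (GrPiece.mk I a ha) (GrPiece.mk I x hx) =
      GrPiece.mk I (a • x) (GrPiece.smul_mem ha hx) := rfl

theorem GrPiece.sigma_ext {i j : ℕ} {x y : M} (hx : x ∈ I ^ i • (⊤ : Submodule R M))
    (hy : y ∈ I ^ j • (⊤ : Submodule R M)) (hij : i = j) (hxy : x = y) :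
    GradedMonoid.mk (A := GrPiece I M) i (GrPiece.mk I x hx) =
      GradedMonoid.mk j (GrPiece.mk I y hy) := by
  subst hij hxy
  rfl

/-- The class of `1` in `I ^ 0 / I ^ 1`. -/
instance GrPiece.gOne : GradedMonoid.GOne (GrPiece I R) where
  one := GrPiece.mk I 1 GrPiece.one_mem

/-- The graded multiplication on the quotients `I ^ n / I ^ (n + 1)`. -/
instance GrPiece.gMul : GradedMonoid.GMul (GrPiece I R) where
  mul {i j} a b := GrPiece.smul I R i j a b

/-- The graded multiplication on the quotients `I ^ n / I ^ (n + 1)` is associative and unital. -/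
instance GrPiece.gMonoid : GradedMonoid.GMonoid (GrPiece I R) where
  one_mul := by
    rintro ⟨i, a⟩
    obtain ⟨a, ha, rfl⟩ := GrPiece.mk_surj a
    exact GrPiece.sigma_ext _ _ (zero_add i) (one_mul a)
  mul_one := by
    rintro ⟨i, a⟩
    obtain ⟨a, ha, rfl⟩ := GrPiece.mk_surj a
    exact GrPiece.sigma_ext _ _ (add_zero i) (mul_one a)
  mul_assoc := by
    rintro ⟨i, a⟩ ⟨j, b⟩ ⟨k, c⟩
    obtain ⟨a, ha, rfl⟩ := GrPiece.mk_surj a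
    obtain ⟨b, hb, rfl⟩ := GrPiece.mk_surj b
    obtain ⟨c, hc, rfl⟩ := GrPiece.mk_surj c
    exact GrPiece.sigma_ext _ _ (add_assoc i j k) (mul_assoc a b c)

/-- The graded ring structure on the quotients `I ^ n / I ^ (n + 1)`. -/
instance GrPiece.gCommRing : GCommRing (GrPiece I R) where
  __ := GrPiece.gMonoid
  mul_zero {i j} a := map_zero (GrPiece.smul I R i j a)
  zero_mul {i j} b := LinearMap.map_zero₂ (GrPiece.smul I R i j) b
  mul_add {i j} a b c := map_add (GrPiece.smul I R i j a) b c
  add_mul {i j} a b c := LinearMap.map_add₂ (GrPiece.smul I R i j) a b c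
  mul_comm := by
    rintro ⟨i, a⟩ ⟨j, b⟩
    obtain ⟨a, ha, rfl⟩ := GrPiece.mk_surj a
    obtain ⟨b, hb, rfl⟩ := GrPiece.mk_surj b
    exact GrPiece.sigma_ext _ _ (add_comm i j) (mul_comm a b)
  natCast n := n • GrPiece.mk I 1 GrPiece.one_mem
  natCast_zero := zero_smul _ _
  natCast_succ n := succ_nsmul _ n
  intCast n := n • GrPiece.mk I 1 GrPiece.one_mem
  intCast_ofNat n := natCast_zsmul _ n
  intCast_negSucc_ofNat n := negSucc_zsmul _ n

/-- The graded action of the `I ^ n / I ^ (n + 1)` on the `I ^ n M / I ^ (n + 1) M`. -/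
instance GrPiece.gmodule : Gmodule (GrPiece I R) (GrPiece I M) where
  smul {i j} a x := GrPiece.smul I M i j a x
  smul_add {i j} a x y := map_add (GrPiece.smul I M i j a) x y
  smul_zero {i j} a := map_zero (GrPiece.smul I M i j a)
  add_smul {i j} a b x := LinearMap.map_add₂ (GrPiece.smul I M i j) a b x
  zero_smul {i j} x := LinearMap.map_zero₂ (GrPiece.smul I M i j) x
  one_smul := by
    rintro ⟨i, x⟩
    obtain ⟨x, hx, rfl⟩ := GrPiece.mk_surj x
    exact GrPiece.sigma_ext _ _ (zero_add i) (one_smul R x)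
  mul_smul := by
    rintro ⟨i, a⟩ ⟨j, b⟩ ⟨k, x⟩
    obtain ⟨a, ha, rfl⟩ := GrPiece.mk_surj a
    obtain ⟨b, hb, rfl⟩ := GrPiece.mk_surj b
    obtain ⟨x, hx, rfl⟩ := GrPiece.mk_surj x
    exact GrPiece.sigma_ext _ _ (add_assoc i j k) (mul_smul a b x)

variable (I M)

/-- The associated graded ring `G_I(R) = ⨁ n, I ^ n / I ^ (n + 1)`. -/
def AssocGradedRing : Type u := ⨁ n : ℕ, GrPiece I R n

instance : CommRing (AssocGradedRing I) :=
  inferInstanceAs (CommRing (⨁ n : ℕ, GrPiece I R n))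

/-- The associated graded module `G_I(M) = ⨁ n, I ^ n M / I ^ (n + 1) M`. -/
def AssocGradedModule : Type v := ⨁ n : ℕ, GrPiece I M n

instance : AddCommGroup (AssocGradedModule I M) :=
  inferInstanceAs (AddCommGroup (⨁ n : ℕ, GrPiece I M n))

instance : Module (AssocGradedRing I) (AssocGradedModule I M) :=
  inferInstanceAs (Module (⨁ n : ℕ, GrPiece I R n) (⨁ n : ℕ, GrPiece I M n))

/-- The inclusion of `I ^ n / I ^ (n + 1)` into `G_I(R)`. -/
def AssocGradedRing.of (n : ℕ) : GrPiece I R n →+ AssocGradedRing I :=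
  DirectSum.of (GrPiece I R) n

/-- The inclusion of `I ^ n M / I ^ (n + 1) M` into `G_I(M)`. -/
def AssocGradedModule.of (n : ℕ) : GrPiece I M n →+ AssocGradedModule I M :=
  DirectSum.of (GrPiece I M) n

/-- The homogeneous component of degree `n` of `G_I(R)`. -/
def AssocGradedRing.component (n : ℕ) : AddSubgroup (AssocGradedRing I) :=
  (AssocGradedRing.of I n).range

/-- The homogeneous component of degree `n` of `G_I(M)`. -/
def AssocGradedModule.component (n : ℕ) : AddSubgroup (AssocGradedModule I M) :=
  (AssocGradedModule.of I M n).range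

/-- The decomposition of an element of `G_I(R)` into homogeneous components. -/
def AssocGradedRing.decomposeHom :
    AssocGradedRing I →+ ⨁ n : ℕ, AssocGradedRing.component I n :=
  DirectSum.toAddMonoid (β := GrPiece I R) fun n =>
    (DirectSum.of (fun n => AssocGradedRing.component I n) n).comp
      (AssocGradedRing.of I n).rangeRestrict

theorem AssocGradedRing.decomposeHom_of (n : ℕ) (x : GrPiece I R n) :
    AssocGradedRing.decomposeHom I (AssocGradedRing.of I n x) =
      DirectSum.of (fun n => AssocGradedRing.component I n) n
        ((AssocGradedRing.of I n).rangeRestrict x) :=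
  DirectSum.toAddMonoid_of _ n x

/-- `G_I(R)` is a graded ring. -/
instance : GradedRing (AssocGradedRing.component I) where
  one_mem := ⟨GradedMonoid.GOne.one, rfl⟩
  mul_mem := by
    rintro i j _ _ ⟨a, rfl⟩ ⟨b, rfl⟩
    exact ⟨GradedMonoid.GMul.mul a b, (DirectSum.of_mul_of a b).symm⟩
  decompose' := AssocGradedRing.decomposeHom I
  left_inv := by
    suffices h : (DirectSum.coeAddMonoidHom (AssocGradedRing.component I)).comp
        (AssocGradedRing.decomposeHom I) = AddMonoidHom.id (AssocGradedRing I) from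
      fun x => DFunLike.congr_fun h x
    refine DirectSum.addHom_ext (β := GrPiece I R) fun n x => ?_
    change DirectSum.coeAddMonoidHom (AssocGradedRing.component I)
      (AssocGradedRing.decomposeHom I (AssocGradedRing.of I n x)) = AssocGradedRing.of I n x
    rw [AssocGradedRing.decomposeHom_of]
    exact DirectSum.coeAddMonoidHom_of (AssocGradedRing.component I) n _
  right_inv := by
    suffices h : (AssocGradedRing.decomposeHom I).comp
        (DirectSum.coeAddMonoidHom (AssocGradedRing.component I)) =
        AddMonoidHom.id (⨁ n : ℕ, AssocGradedRing.component I n) from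
      fun x => DFunLike.congr_fun h x
    refine DirectSum.addHom_ext fun n x => ?_
    obtain ⟨_, y, rfl⟩ := x
    rw [AddMonoidHom.comp_apply, DirectSum.coeAddMonoidHom_of, AssocGradedRing.decomposeHom_of]
    rfl

variable {I M} in
/-- The order `ν(x) = min {i | x ∈ I ^ i M \ I ^ (i + 1) M}` of an element `x` of `M`. The set is
empty when `x` lies in every `I ^ i M` (in the local Noetherian situation: when `x = 0`), and the
value is then `0`. -/
def adicOrder (I : Ideal R) (x : M) : ℕ :=
  sInf {i : ℕ | x ∈ I ^ i • (⊤ : Submodule R M) ∧ x ∉ I ^ (i + 1) • (⊤ : Submodule R M)}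

end AssociatedGraded

/-! ### Minimal free resolutions -/

section Resolutions

universe u v

/-- A minimal resolution of the `A`-module `M` by free modules `F i = A ^ (rank i)`, where
minimality is with respect to an ideal `J` (the maximal ideal of a local ring, or the irrelevant
ideal of a graded ring):
`⋯ ⟶ F 2 --d 1--> F 1 --d 0--> F 0 --aug--> M ⟶ 0`.
Thus `d i : F (i + 1) → F i` is the map usually called `φ_{i+1}`, and `aug` is `φ_0`. -/
structure MinimalFreeResolution {A : Type u} [CommRing A] (J : Ideal A)
    (M : Type v) [AddCommGroup M] [Module A M] where
  rank : ℕ → ℕ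
  aug : (Fin (rank 0) → A) →ₗ[A] M
  d (i : ℕ) : (Fin (rank (i + 1)) → A) →ₗ[A] (Fin (rank i) → A)
  aug_surjective : Function.Surjective aug
  exact_aug : Function.Exact (d 0) aug
  exact_d (i : ℕ) : Function.Exact (d (i + 1)) (d i)
  minimal_aug : LinearMap.ker aug ≤ J • (⊤ : Submodule A (Fin (rank 0) → A))
  minimal_d (i : ℕ) : LinearMap.ker (d i) ≤ J • (⊤ : Submodule A (Fin (rank (i + 1)) → A))

/-- For a resolution `F`, `F.syzygySucc i` is the syzygy module `Ω_{i+1} ⊆ F i`, that is, the kernel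
of `φ_i : F i → F (i - 1)` (of the augmentation, when `i = 0`). -/
def MinimalFreeResolution.syzygySucc {A : Type u} [CommRing A] {J : Ideal A}
    {M : Type v} [AddCommGroup M] [Module A M] (F : MinimalFreeResolution J M) :
    (i : ℕ) → Submodule A (Fin (F.rank i) → A)
  | 0 => LinearMap.ker F.aug
  | i + 1 => LinearMap.ker (F.d i)

/-- A family indexed by `ℕ`, extended by `0` to a family indexed by `ℤ`. -/
def extendToInt {M : Type v} [AddCommGroup M] (ℳ : ℕ → AddSubgroup M) : ℤ → AddSubgroup M
  | Int.ofNat n => ℳ n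
  | Int.negSucc _ => ⊥

variable {A : Type u} [CommRing A] (𝒜 : ℕ → AddSubgroup A) [GradedRing 𝒜]

/-- The homogeneous component of degree `n` of the graded free module `⨁ l, A(-deg l)`, whose `l`-th
basis vector is homogeneous of degree `deg l`. -/
def gradedFreeComponent {b : ℕ} (deg : Fin b → ℤ) (n : ℤ) : AddSubgroup (Fin b → A) :=
  AddSubgroup.pi Set.univ fun l => extendToInt 𝒜 (n - deg l)

/-- The irrelevant ideal `A_+ = ⨁ n > 0, 𝒜 n`. -/
abbrev irrelevantIdeal : Ideal A := (HomogeneousIdeal.irrelevant 𝒜).toIdeal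

/-- A minimal graded free resolution, over the graded ring `(A, 𝒜)`, of a graded `A`-module with
homogeneous components `ℳ n`, `n ∈ ℤ`. The `i`-th free module is `⨁ l, A(-deg i l)`, and all maps
are graded of degree `0`. -/
structure MinimalGradedFreeResolution {M : Type v} [AddCommGroup M] [Module A M]
    (ℳ : ℤ → AddSubgroup M) extends MinimalFreeResolution (irrelevantIdeal 𝒜) M where
  deg (i : ℕ) : Fin (rank i) → ℤ
  aug_graded (n : ℤ) : ∀ x ∈ gradedFreeComponent 𝒜 (deg 0) n, aug x ∈ ℳ n
  d_graded (i : ℕ) (n : ℤ) : ∀ x ∈ gradedFreeComponent 𝒜 (deg (i + 1)) n,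
    d i x ∈ gradedFreeComponent 𝒜 (deg i) n

namespace MinimalGradedFreeResolution

variable {𝒜} {M : Type v} [AddCommGroup M] [Module A M] {ℳ : ℤ → AddSubgroup M}

/-- The graded Betti number `β_{i,j}`: the number of basis elements of degree `j` of the `i`-th free
module of the minimal resolution (which map to the minimal generators of degree `j` of the `i`-th
syzygy module). -/
def betti (F : MinimalGradedFreeResolution 𝒜 ℳ) (i : ℕ) (j : ℤ) : ℕ :=
  Fintype.card {l : Fin (F.rank i) // F.deg i l = j}

/-- For every `i` there is at most one `j` with `β_{i,j} ≠ 0`. -/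
def IsPure (F : MinimalGradedFreeResolution 𝒜 ℳ) : Prop :=
  ∀ (i : ℕ) (j j' : ℤ), F.betti i j ≠ 0 → F.betti i j' ≠ 0 → j = j'

/-- There is `δ₀` such that `β_{i,j} ≠ 0` implies `j = δ₀ + i`. -/
def IsLinear (F : MinimalGradedFreeResolution 𝒜 ℳ) : Prop :=
  ∃ δ₀ : ℤ, ∀ (i : ℕ) (j : ℤ), F.betti i j ≠ 0 → j = δ₀ + i

/-- The grading of the syzygy module `Ω_{i+1} ⊆ F i` inherited from the graded module `F i`. -/
def syzygySuccComponent (F : MinimalGradedFreeResolution 𝒜 ℳ) (i : ℕ) (n : ℤ) :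
    AddSubgroup (F.syzygySucc i) :=
  (gradedFreeComponent 𝒜 (F.deg i) n).comap (F.syzygySucc i).subtype.toAddMonoidHom

end MinimalGradedFreeResolution

/-- The graded module with components `ℳ n` has a pure resolution. -/
def HasPureResolution {M : Type v} [AddCommGroup M] [Module A M] (ℳ : ℤ → AddSubgroup M) : Prop :=
  ∃ F : MinimalGradedFreeResolution 𝒜 ℳ, F.IsPure

/-- The graded module with components `ℳ n` has a linear resolution. -/
def HasLinearResolution {M : Type v} [AddCommGroup M] [Module A M] (ℳ : ℤ → AddSubgroup M) : Prop :=
  ∃ F : MinimalGradedFreeResolution 𝒜 ℳ, F.IsLinear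

/-- The grading of the residue module `A / A_+`, concentrated in degree `0`. -/
def residueComponent (n : ℤ) : AddSubgroup (A ⧸ irrelevantIdeal 𝒜) :=
  if n = 0 then ⊤ else ⊥

/-- For a standard graded algebra `A` over the field `k = 𝒜 0 = A / A_+`: the algebra `A` is Koszul,
that is, the graded `A`-module `k` has a linear resolution. -/
def IsKoszulAlgebra : Prop :=
  HasLinearResolution 𝒜 (residueComponent 𝒜)

end Resolutions

/-- A Noetherian local ring `R` with maximal ideal `𝔪` is Koszul if `G_𝔪(R)`, which is a standard
graded algebra over the residue field, is a Koszul algebra. -/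
def IsKoszulLocalRing (R : Type*) [CommRing R] [IsLocalRing R] : Prop :=
  IsNoetherianRing R ∧ IsKoszulAlgebra (AssocGradedRing.component (maximalIdeal R))

/-! ### Fibre products -/

section FibreProduct

variable {R₁ R₂ k : Type*} [CommRing R₁] [IsLocalRing R₁] [CommRing R₂] [IsLocalRing R₂] [Field k]

/-- For local rings `R₁` and `R₂` whose residue fields are identified with the field `k`, the fibre
product `R₁ ×_k R₂ = {(a, b) | π₁ a = π₂ b}`, where `π₁` and `π₂` are the natural projections
to `k`. -/
def fibreProduct (ι₁ : ResidueField R₁ ≃+* k) (ι₂ : ResidueField R₂ ≃+* k) : Subring (R₁ × R₂) :=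
  RingHom.eqLocus
    ((ι₁.toRingHom.comp (residue R₁)).comp (RingHom.fst R₁ R₂))
    ((ι₂.toRingHom.comp (residue R₂)).comp (RingHom.snd R₁ R₂))

/-- A fibre product of local rings over their residue field is local. -/
instance fibreProduct.isLocalRing (ι₁ : ResidueField R₁ ≃+* k) (ι₂ : ResidueField R₂ ≃+* k) :
    IsLocalRing (fibreProduct ι₁ ι₂) := by
  have key : ∀ x : fibreProduct ι₁ ι₂, IsUnit x.1.1 → IsUnit x := by
    intro x h₁
    have hx : ι₁ (residue R₁ x.1.1) = ι₂ (residue R₂ x.1.2) := x.2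
    have h₂ : IsUnit x.1.2 := by
      rw [← residue_ne_zero_iff_isUnit] at h₁ ⊢
      intro h0
      rw [h0, map_zero] at hx
      exact h₁ ((map_eq_zero_iff ι₁ ι₁.injective).1 hx)
    obtain ⟨a, ha⟩ := h₁.exists_right_inv
    obtain ⟨b, hb⟩ := h₂.exists_right_inv
    have hab : (a, b) ∈ fibreProduct ι₁ ι₂ := by
      change ι₁ (residue R₁ a) = ι₂ (residue R₂ b)
      have e₁ : ι₁ (residue R₁ x.1.1) * ι₁ (residue R₁ a) = 1 := by
        rw [← map_mul, ← map_mul, ha, map_one, map_one]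
      have e₂ : ι₂ (residue R₂ x.1.2) * ι₂ (residue R₂ b) = 1 := by
        rw [← map_mul, ← map_mul, hb, map_one, map_one]
      rw [← hx] at e₂
      exact mul_left_cancel₀ (left_ne_zero_of_mul_eq_one e₁) (e₁.trans e₂.symm)
    exact IsUnit.of_mul_eq_one ⟨(a, b), hab⟩ (Subtype.ext (Prod.ext ha hb))
  refine IsLocalRing.of_isUnit_or_isUnit_one_sub_self fun x => ?_
  exact (IsLocalRing.isUnit_or_isUnit_one_sub_self x.1.1).imp (key x) (key (1 - x))

end FibreProduct

end

noncomputable section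

/-! ### Free modules of column vectors -/

section FreeVectors

variable {A : Type*} [CommRing A]

/-! Write `A` for the associated graded ring and `A_+` for its irrelevant ideal. The maximal ideal
of the fibre product is the direct sum of the kernels of the two projections. This passes to initial
ideals: `A_+ ⊆ I + J` with `I ∩ J = 0`, so `I J = 0`. As neither ring is a field, `I` and `J` each
contain a form of degree 1 with no annihilator in degree 0 (`fibreProduct.irrelevantIdealSplits`).

Linearity. A vector of the second or a higher syzygy has entries in `A_+`, so it is `y + z` with
entries in `I` and in `J`. The next map sends `y` and `z` to opposite vectors with entries in `I ∩ J
= 0`, so both are syzygies. Applied to a minimal generator this gives a vector `f`, nonzero modulo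
`A_+`, whose image has all entries in `I` (or all in `J`). A form `b` of degree 1 in the other ideal
makes `b f` a relation with nonzero entries in degree 1 above `f`. By purity the relations are
generated in a single degree `e ≥ 1` above, so `e = 1` (`shift_eq_one`). Thus all shifts from `F_2 →
F_3` on are 1, and the truncation resolving the second syzygy is linear.

Columns. A pure resolution of the graded module lifts, one map at a time, to a minimal resolution of
`M`: strictness of each map turns lifts of columns into syzygies with the same symbols, and Krull's
intersection theorem gives exactness and strictness of the next map (`IsStrictLift.exists_next`). In
the lifted resolution a vector nonzero modulo the maximal ideal `𝔪` is mapped outside `𝔪 ^ (e + 1)`.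
Comparing minimal resolutions transfers this to every minimal resolution (`adicOrder_d_single`). -/

theorem mem_smul_top_pi_iff {ι : Type*} [Finite ι] (J : Ideal A) (x : ι → A) :
    x ∈ J • (⊤ : Submodule A (ι → A)) ↔ ∀ l, x l ∈ J := by
  classical
  cases nonempty_fintype ι
  constructor
  · intro hx l
    have h : J • (⊤ : Submodule A (ι → A)) ≤
        Submodule.comap (LinearMap.proj (R := A) (φ := fun _ : ι => A) l) J :=
      Submodule.smul_le.2 fun r hr n _ => J.mul_mem_right (n l) hr
    exact h hx
  · intro hx
    rw [← Finset.univ_sum_single x]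
    refine Submodule.sum_mem _ fun l _ => ?_
    have : Pi.single l (x l) = x l • (Pi.single l (1 : A) : ι → A) := by
      rw [← Pi.single_smul, smul_eq_mul, mul_one]
    rw [this]
    exact Submodule.smul_mem_smul (hx l) trivial

theorem map_mem_smul_top {N P : Type*} [AddCommGroup N] [Module A N] [AddCommGroup P] [Module A P]
    (J : Ideal A) (f : N →ₗ[A] P) {x : N} (hx : x ∈ J • (⊤ : Submodule A N)) :
    f x ∈ J • (⊤ : Submodule A P) := by
  have h := Submodule.mem_map_of_mem (f := f) hx
  rw [Submodule.map_smul''] at h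
  exact Submodule.smul_mono le_rfl le_top h

theorem single_one_notMem_smul_top {b : ℕ} {J : Ideal A} (hJ : J ≠ ⊤) (l : Fin b) :
    (Pi.single l 1 : Fin b → A) ∉ J • (⊤ : Submodule A (Fin b → A)) := by
  rw [mem_smul_top_pi_iff]
  intro h
  have := h l
  rw [Pi.single_eq_same] at this
  exact hJ ((Ideal.eq_top_iff_one J).2 this)

theorem map_eq_sum_smul {N : Type*} [AddCommGroup N] [Module A N] {b : ℕ}
    (f : (Fin b → A) →ₗ[A] N) (x : Fin b → A) : f x = ∑ l, x l • f (Pi.single l 1) := by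
  conv_lhs => rw [pi_eq_sum_univ' x]
  simp only [map_sum, map_smul]

theorem exists_linearMap_single {N : Type*} [AddCommGroup N] [Module A N] {b : ℕ}
    (y : Fin b → N) : ∃ f : (Fin b → A) →ₗ[A] N, ∀ l, f (Pi.single l 1) = y l :=
  ⟨(Pi.basisFun A (Fin b)).constr A y, fun l => by
    rw [← Pi.basisFun_apply]; exact Module.Basis.constr_basis _ _ _ _⟩

theorem linearMap_ext_single {N : Type*} [AddCommGroup N] [Module A N] {b : ℕ}
    {f g : (Fin b → A) →ₗ[A] N} (h : ∀ l, f (Pi.single l 1) = g (Pi.single l 1)) : f = g :=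
  (Pi.basisFun A (Fin b)).ext fun l => by simpa using h l

theorem exists_linearMap_lift {N P : Type*} [AddCommGroup N] [Module A N] [AddCommGroup P]
    [Module A P] {b : ℕ} (p : N →ₗ[A] P) (f : (Fin b → A) →ₗ[A] P) (S : Fin b → Set N)
    (h : ∀ l, ∃ y ∈ S l, p y = f (Pi.single l 1)) :
    ∃ α : (Fin b → A) →ₗ[A] N, (∀ l, α (Pi.single l 1) ∈ S l) ∧ ∀ x, p (α x) = f x := by
  choose y hyS hy using h
  obtain ⟨α, hα⟩ := exists_linearMap_single (A := A) y
  refine ⟨α, fun l => by rw [hα]; exact hyS l, fun x => ?_⟩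
  have : p ∘ₗ α = f := linearMap_ext_single fun l => by
    rw [LinearMap.comp_apply, hα, hy]
  exact LinearMap.congr_fun this x

end FreeVectors

/-! ### Comparison of minimal free resolutions -/

namespace MinimalFreeResolution

variable {A : Type*} [CommRing A] {J : Ideal A} {M : Type*} [AddCommGroup M] [Module A M]

theorem d_d (F : MinimalFreeResolution J M) (i : ℕ) (x) : F.d i (F.d (i + 1) x) = 0 :=
  (F.exact_d i _).2 ⟨x, rfl⟩

theorem aug_d (F : MinimalFreeResolution J M) (x) : F.aug (F.d 0 x) = 0 :=
  (F.exact_aug _).2 ⟨x, rfl⟩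

theorem d_mem (F : MinimalFreeResolution J M) (i : ℕ) (x) :
    F.d i x ∈ J • (⊤ : Submodule A (Fin (F.rank i) → A)) := by
  cases i with
  | zero => exact F.minimal_aug (F.aug_d x)
  | succ i => exact F.minimal_d i (F.d_d i x)

theorem rank_succ_eq_zero (F : MinimalFreeResolution J M) (hJ : J ≠ ⊤) {i : ℕ}
    (h : F.rank i = 0) : F.rank (i + 1) = 0 := by
  by_contra h'
  let l : Fin (F.rank (i + 1)) := ⟨0, Nat.pos_of_ne_zero h'⟩
  refine single_one_notMem_smul_top hJ l (F.minimal_d i ?_)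
  rw [LinearMap.mem_ker]
  ext j
  rw [h] at j
  exact j.elim0

/-- A chain map between two resolutions of `M` that lifts the identity of `M`. -/
structure Comparison (F G : MinimalFreeResolution J M) where
  map (i : ℕ) : (Fin (F.rank i) → A) →ₗ[A] (Fin (G.rank i) → A)
  aug_map (x) : G.aug (map 0 x) = F.aug x
  d_map (i : ℕ) (x) : G.d i (map (i + 1) x) = map i (F.d i x)

/-- The sets `S` let one induction serve twice: with the whole modules it gives ordinary comparison
maps, with homogeneous components it gives graded ones. -/
theorem exists_comparison (F G : MinimalFreeResolution J M)
    (S : ∀ i, Fin (F.rank i) → Set (Fin (G.rank i) → A))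
    (h0 : ∀ l, ∃ y ∈ S 0 l, G.aug y = F.aug (Pi.single l 1))
    (hs : ∀ i (α : (Fin (F.rank i) → A) →ₗ[A] (Fin (G.rank i) → A)),
      (∀ l, α (Pi.single l 1) ∈ S i l) → ∀ l,
      α (F.d i (Pi.single l 1)) ∈ LinearMap.range (G.d i) →
      ∃ y ∈ S (i + 1) l, G.d i y = α (F.d i (Pi.single l 1))) :
    ∃ α : Comparison F G, ∀ i l, α.map i (Pi.single l 1) ∈ S i l := by
  obtain ⟨α₀, hα₀, h₀⟩ := exists_linearMap_lift G.aug F.aug (S 0) h0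
  -- The stored invariant, that the composite lands in the range of `G.d i`, is what permits the
  -- next lift.
  let T (i : ℕ) : Type _ := {α : (Fin (F.rank i) → A) →ₗ[A] (Fin (G.rank i) → A) //
    (∀ l, α (Pi.single l 1) ∈ S i l) ∧ ∀ x, α (F.d i x) ∈ LinearMap.range (G.d i)}
  have step (i : ℕ) (α : T i) : ∃ β : T (i + 1), ∀ x, G.d i (β.1 x) = α.1 (F.d i x) := by
    obtain ⟨β, hβ, h⟩ := exists_linearMap_lift (G.d i) (α.1 ∘ₗ F.d i) (S (i + 1))
      fun l => hs i α.1 α.2.1 l (α.2.2 _)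
    refine ⟨⟨β, hβ, fun x => (G.exact_d i _).1 ?_⟩, h⟩
    rw [h, LinearMap.comp_apply, d_d, map_zero]
  choose next hnext using step
  let seq (i : ℕ) : T i := Nat.rec (motive := T)
    ⟨α₀, hα₀, fun x => (G.exact_aug _).1 (by rw [h₀, aug_d])⟩ next i
  exact ⟨⟨fun i => (seq i).1, h₀, fun i x => hnext i (seq i) x⟩, fun i l => (seq i).2.1 l⟩

theorem exists_comparison' (F G : MinimalFreeResolution J M) : Nonempty (Comparison F G) :=
  (exists_comparison F G (fun _ _ => Set.univ)
    (fun _ => (G.aug_surjective _).imp fun _ h => ⟨trivial, h⟩)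
    fun _ _ _ _ ⟨y, h⟩ => ⟨y, trivial, h⟩).nonempty

/-- Chain endomorphisms of a minimal resolution that lift the identity are the identity
modulo `J`. -/
theorem Comparison.comp_sub_mem {F G : MinimalFreeResolution J M} (α : Comparison F G)
    (β : Comparison G F) (i : ℕ) (x : Fin (F.rank i) → A) :
    β.map i (α.map i x) - x ∈ J • (⊤ : Submodule A (Fin (F.rank i) → A)) := by
  -- A homotopy `h` contracting the difference up to cycles suffices: cycles lie in `J` times the
  -- free module by minimality, and so does `h (F.d i x)`, because the values of `F.d i` do.
  have key (i : ℕ) : ∃ h : (Fin (F.rank i) → A) →ₗ[A] (Fin (F.rank (i + 1)) → A),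
      ∀ x, F.d i (β.map (i + 1) (α.map (i + 1) x) - x - h (F.d i x)) = 0 := by
    induction i with
    | zero =>
      obtain ⟨h, -, hh⟩ := exists_linearMap_lift (F.d 0) (β.map 0 ∘ₗ α.map 0 - LinearMap.id)
        (fun _ => Set.univ) fun l => by
          obtain ⟨y, hy⟩ := (F.exact_aug ((β.map 0 ∘ₗ α.map 0 - LinearMap.id :
            (Fin (F.rank 0) → A) →ₗ[A] _) (Pi.single l 1))).1 (by
              simp [β.aug_map, α.aug_map])
          exact ⟨y, trivial, hy⟩
      refine ⟨h, fun x => ?_⟩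
      rw [map_sub, map_sub, hh, β.d_map, α.d_map]
      simp
    | succ i ih =>
      obtain ⟨h, hh⟩ := ih
      obtain ⟨h', -, hh'⟩ := exists_linearMap_lift (F.d (i + 1))
        (β.map (i + 1) ∘ₗ α.map (i + 1) - LinearMap.id - h ∘ₗ F.d i)
        (fun _ => Set.univ) fun l => by
          obtain ⟨y, hy⟩ := (F.exact_d i _).1 (hh (Pi.single l 1))
          exact ⟨y, trivial, hy⟩
      refine ⟨h', fun x => ?_⟩
      rw [map_sub, map_sub, hh', β.d_map, α.d_map]
      simp [d_d]
  cases i with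
  | zero =>
    refine F.minimal_aug ?_
    rw [LinearMap.mem_ker, map_sub, β.aug_map, α.aug_map, sub_self]
  | succ i =>
    obtain ⟨h, hh⟩ := key i
    have h1 := F.minimal_d i (hh x)
    have h2 := map_mem_smul_top J h (F.d_mem i x)
    simpa using add_mem h1 h2

end MinimalFreeResolution

/-! ### Homogeneous parts -/

section HomogeneousParts

/-- The maps `π n` project onto the members `ℳ n` of a family of subgroups, along the other
members. -/
def IsGradedProjection {ι M : Type*} [AddCommGroup M] (ℳ : ι → AddSubgroup M)
    (π : ι → M →+ M) : Prop :=
  ∀ n, (∀ x ∈ ℳ n, π n x = x) ∧ ∀ m, m ≠ n → ∀ x ∈ ℳ m, π n x = 0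

/-- A family of endomorphisms indexed by `ℕ`, extended by `0` to `ℤ`. -/
def extendHomToInt {M : Type*} [AddCommGroup M] (π : ℕ → M →+ M) : ℤ → M →+ M
  | Int.ofNat n => π n
  | Int.negSucc _ => 0

theorem IsGradedProjection.extendToInt {M : Type*} [AddCommGroup M] {ℳ : ℕ → AddSubgroup M}
    {π : ℕ → M →+ M} (h : IsGradedProjection ℳ π) :
    IsGradedProjection (extendToInt ℳ) (extendHomToInt π) := by
  intro n
  rcases n with n | n
  · refine ⟨(h n).1, fun m hm x hx => ?_⟩
    rcases m with m | m
    · exact (h n).2 m (fun e => hm (congrArg _ e)) x hx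
    · have : x = 0 := hx
      rw [this, map_zero]
  · refine ⟨fun x hx => ?_, fun m hm x hx => rfl⟩
    have : x = 0 := hx
    rw [this, map_zero]

theorem extendToInt_natCast {M : Type*} [AddCommGroup M] (ℳ : ℕ → AddSubgroup M) (n : ℕ) :
    extendToInt ℳ n = ℳ n := rfl

theorem extendToInt_of_neg {M : Type*} [AddCommGroup M] (ℳ : ℕ → AddSubgroup M) {n : ℤ}
    (hn : n < 0) : extendToInt ℳ n = ⊥ := by
  obtain ⟨k, rfl⟩ := Int.eq_negSucc_of_lt_zero hn
  rfl

theorem mem_gradedFreeComponent_iff {A : Type*} [CommRing A] (𝒜 : ℕ → AddSubgroup A) {b : ℕ}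
    (deg : Fin b → ℤ) {n : ℤ} {x : Fin b → A} :
    x ∈ gradedFreeComponent 𝒜 deg n ↔ ∀ l, x l ∈ extendToInt 𝒜 (n - deg l) := by
  simp [gradedFreeComponent, AddSubgroup.mem_pi]

theorem single_mem_gradedFreeComponent {A : Type*} [CommRing A] (𝒜 : ℕ → AddSubgroup A) {b : ℕ}
    (deg : Fin b → ℤ) {n : ℕ} {a : A} (ha : a ∈ 𝒜 n) (l : Fin b) :
    (Pi.single l a : Fin b → A) ∈ gradedFreeComponent 𝒜 deg (n + deg l) := by
  rw [mem_gradedFreeComponent_iff]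
  intro j
  rcases eq_or_ne j l with rfl | hj
  · rw [Pi.single_eq_same, add_sub_cancel_right]
    exact ha
  · rw [Pi.single_eq_of_ne hj]
    exact zero_mem _

variable {A : Type*} [CommRing A] (𝒜 : ℕ → AddSubgroup A) [GradedRing 𝒜]

theorem isGradedProjection_proj : IsGradedProjection 𝒜 (GradedRing.proj 𝒜) := by
  intro n
  refine ⟨fun x hx => ?_, fun m hm x hx => ?_⟩
  · rw [GradedRing.proj_apply, decompose_of_mem_same _ hx]
  · rw [GradedRing.proj_apply, decompose_of_mem_ne _ hx hm]

theorem extendHomToInt_proj_mem (n : ℤ) (a : A) :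
    extendHomToInt (GradedRing.proj 𝒜) n a ∈ extendToInt 𝒜 n := by
  rcases n with n | n
  · exact SetLike.coe_mem _
  · exact zero_mem (⊥ : AddSubgroup A)

theorem mem_irrelevantIdeal_of_mem {n : ℕ} (hn : n ≠ 0) {a : A} (ha : a ∈ 𝒜 n) :
    a ∈ irrelevantIdeal 𝒜 :=
  (HomogeneousIdeal.mem_irrelevant_iff 𝒜 a).2 ((isGradedProjection_proj 𝒜 0).2 n hn a ha)

theorem mem_irrelevantIdeal_of_mem_extendToInt {n : ℤ} (hn : n ≠ 0) {a : A}
    (ha : a ∈ extendToInt 𝒜 n) : a ∈ irrelevantIdeal 𝒜 := by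
  rcases n with n | n
  · exact mem_irrelevantIdeal_of_mem 𝒜 (fun e => hn (by rw [e]; rfl)) ha
  · have : a = 0 := ha
    rw [this]
    exact zero_mem _

theorem eq_zero_of_mem_irrelevantIdeal {a : A} (ha : a ∈ irrelevantIdeal 𝒜) (h : a ∈ 𝒜 0) :
    a = 0 := by
  rw [← (isGradedProjection_proj 𝒜 0).1 a h]
  exact (HomogeneousIdeal.mem_irrelevant_iff 𝒜 a).1 ha

theorem irrelevantIdeal_ne_top [Nontrivial A] : irrelevantIdeal 𝒜 ≠ ⊤ := by
  intro h
  exact one_ne_zero (eq_zero_of_mem_irrelevantIdeal 𝒜 (a := 1) (by rw [h]; trivial)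
    SetLike.GradedOne.one_mem)

variable {b : ℕ} (deg : Fin b → ℤ)

/-- The homogeneous part of degree `n` of a vector of the graded free module `⨁ l, A(-deg l)`. -/
def gradedFreeProj (n : ℤ) : (Fin b → A) →+ (Fin b → A) :=
  AddMonoidHom.mk' (fun x l => extendHomToInt (GradedRing.proj 𝒜) (n - deg l) (x l))
    fun x y => by ext l; simp

theorem gradedFreeProj_apply (n : ℤ) (x : Fin b → A) (l : Fin b) :
    gradedFreeProj 𝒜 deg n x l = extendHomToInt (GradedRing.proj 𝒜) (n - deg l) (x l) := rfl

theorem gradedFreeProj_mem (n : ℤ) (x : Fin b → A) :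
    gradedFreeProj 𝒜 deg n x ∈ gradedFreeComponent 𝒜 deg n :=
  (mem_gradedFreeComponent_iff 𝒜 deg).2 fun _ => extendHomToInt_proj_mem 𝒜 _ _

theorem isGradedProjection_gradedFreeProj :
    IsGradedProjection (gradedFreeComponent 𝒜 deg) (gradedFreeProj 𝒜 deg) := by
  intro n
  refine ⟨fun x hx => ?_, fun m hm x hx => ?_⟩ <;> ext l <;>
    rw [mem_gradedFreeComponent_iff] at hx <;> rw [gradedFreeProj_apply]
  · exact ((isGradedProjection_proj 𝒜).extendToInt _).1 _ (hx l)
  · exact ((isGradedProjection_proj 𝒜).extendToInt _).2 _ (by omega) _ (hx l)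

theorem single_one_mem_gradedFreeComponent (l : Fin b) :
    (Pi.single l 1 : Fin b → A) ∈ gradedFreeComponent 𝒜 deg (deg l) := by
  simpa using single_mem_gradedFreeComponent 𝒜 deg
    (SetLike.GradedOne.one_mem : (1 : A) ∈ 𝒜 0) l

/-- Graded maps commute with taking homogeneous parts. -/
theorem map_gradedFreeProj {N : Type*} [AddCommGroup N] [Module A N] {𝒩 : ℤ → AddSubgroup N}
    {π : ℤ → N →+ N} (hπ : IsGradedProjection 𝒩 π) {f : (Fin b → A) →ₗ[A] N}
    (hf : ∀ n, ∀ x ∈ gradedFreeComponent 𝒜 deg n, f x ∈ 𝒩 n) (n : ℤ) (y : Fin b → A) :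
    π n (f y) = f (gradedFreeProj 𝒜 deg n y) := by
  suffices h : (π n).comp f.toAddMonoidHom = f.toAddMonoidHom.comp (gradedFreeProj 𝒜 deg n) from
    DFunLike.congr_fun h y
  refine AddMonoidHom.functions_ext _ _ _ fun l a => ?_
  change π n (f (Pi.single l a)) = f (gradedFreeProj 𝒜 deg n (Pi.single l a))
  induction a using DirectSum.Decomposition.inductionOn 𝒜 with
  | zero => simp
  | @homogeneous m a =>
    have ha := single_mem_gradedFreeComponent 𝒜 deg a.2 l
    have hp := isGradedProjection_gradedFreeProj 𝒜 deg n
    rcases eq_or_ne ((m : ℤ) + deg l) n with rfl | hm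
    · rw [hp.1 _ ha, (hπ _).1 _ (hf _ _ ha)]
    · rw [hp.2 _ hm _ ha, (hπ _).2 _ hm _ (hf _ _ ha), map_zero]
  | add a a' h h' => simp only [Pi.single_add, map_add, h, h']

theorem mul_mem_extendToInt {m n : ℤ} {a c : A} (ha : a ∈ extendToInt 𝒜 m)
    (hc : c ∈ extendToInt 𝒜 n) : a * c ∈ extendToInt 𝒜 (m + n) := by
  rcases m with m | m
  · rcases n with n | n
    · exact SetLike.GradedMul.mul_mem (A := 𝒜) ha hc
    · have : c = 0 := hc
      rw [this, mul_zero]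
      exact zero_mem _
  · have : a = 0 := ha
    rw [this, zero_mul]
    exact zero_mem _

theorem map_mem_gradedFreeComponent {c : ℕ} {deg' : Fin c → ℤ} {α : (Fin b → A) →ₗ[A] (Fin c → A)}
    (hα : ∀ l, α (Pi.single l 1) ∈ gradedFreeComponent 𝒜 deg' (deg l)) {n : ℤ} {x : Fin b → A}
    (hx : x ∈ gradedFreeComponent 𝒜 deg n) : α x ∈ gradedFreeComponent 𝒜 deg' n := by
  rw [map_eq_sum_smul]
  refine sum_mem fun l _ => ?_
  rw [mem_gradedFreeComponent_iff] at hx ⊢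
  intro j
  have := mul_mem_extendToInt 𝒜 (hx l) ((mem_gradedFreeComponent_iff 𝒜 deg').1 (hα l) j)
  rwa [sub_add_sub_cancel] at this

end HomogeneousParts

/-! ### Pure resolutions -/

namespace MinimalGradedFreeResolution

variable {A : Type*} [CommRing A] {𝒜 : ℕ → AddSubgroup A} [GradedRing 𝒜]
  {M : Type*} [AddCommGroup M] [Module A M] {ℳ : ℤ → AddSubgroup M}

/-! ### Degrees of the generators and their independence of the resolution. -/

theorem betti_ne_zero_iff (F : MinimalGradedFreeResolution 𝒜 ℳ) {i : ℕ} {j : ℤ} :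
    F.betti i j ≠ 0 ↔ ∃ l, F.deg i l = j := by
  rw [betti, Ne, Fintype.card_eq_zero_iff, not_isEmpty_iff, nonempty_subtype]

theorem isPure_iff (F : MinimalGradedFreeResolution 𝒜 ℳ) :
    F.IsPure ↔ ∀ i l l', F.deg i l = F.deg i l' := by
  simp only [IsPure, betti_ne_zero_iff]
  constructor
  · intro h i l l'
    exact h i _ _ ⟨l, rfl⟩ ⟨l', rfl⟩
  · rintro h i _ _ ⟨l, rfl⟩ ⟨l', rfl⟩
    exact h i l l'

theorem isLinear_iff (F : MinimalGradedFreeResolution 𝒜 ℳ) :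
    F.IsLinear ↔ ∃ δ₀ : ℤ, ∀ i l, F.deg i l = δ₀ + i := by
  simp only [IsLinear, betti_ne_zero_iff]
  refine exists_congr fun δ₀ => ⟨fun h i l => h i _ ⟨l, rfl⟩, ?_⟩
  rintro h i _ ⟨l, rfl⟩
  exact h i l

theorem exists_graded_comparison {π : ℤ → M →+ M} (hπ : IsGradedProjection ℳ π)
    (F G : MinimalGradedFreeResolution 𝒜 ℳ) :
    ∃ α : MinimalFreeResolution.Comparison F.toMinimalFreeResolution G.toMinimalFreeResolution,
      ∀ i l, α.map i (Pi.single l 1) ∈ gradedFreeComponent 𝒜 (G.deg i) (F.deg i l) := by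
  refine MinimalFreeResolution.exists_comparison F.toMinimalFreeResolution G.toMinimalFreeResolution
    (fun i l => (gradedFreeComponent 𝒜 (G.deg i) (F.deg i l) : Set _)) (fun l => ?_) ?_
  -- A preimage need not be homogeneous, but its part of the right degree is again a preimage,
  -- because the map is graded.
  · obtain ⟨y, hy⟩ := G.aug_surjective (F.aug (Pi.single l 1))
    refine ⟨gradedFreeProj 𝒜 (G.deg 0) (F.deg 0 l) y, gradedFreeProj_mem _ _ _ _, ?_⟩
    rw [← map_gradedFreeProj 𝒜 _ hπ G.aug_graded, hy]
    exact (hπ _).1 _ (F.aug_graded _ _ (single_one_mem_gradedFreeComponent 𝒜 _ l))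
  · rintro i α hα l ⟨y, hy⟩
    refine ⟨gradedFreeProj 𝒜 (G.deg (i + 1)) (F.deg (i + 1) l) y, gradedFreeProj_mem _ _ _ _, ?_⟩
    rw [← map_gradedFreeProj 𝒜 _ (isGradedProjection_gradedFreeProj 𝒜 (G.deg i)) (G.d_graded i),
      hy]
    exact (isGradedProjection_gradedFreeProj 𝒜 (G.deg i) _).1 _
      (map_mem_gradedFreeComponent 𝒜 _ hα
        (F.d_graded i _ _ (single_one_mem_gradedFreeComponent 𝒜 _ l)))

/-- Otherwise a graded comparison sends the basis vector to a vector whose entries all have nonzero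
degree, hence lie in `A_+`. Mapping back would put the basis vector itself in `A_+ F`. -/
theorem exists_deg_eq [Nontrivial A] {π : ℤ → M →+ M} (hπ : IsGradedProjection ℳ π)
    (F G : MinimalGradedFreeResolution 𝒜 ℳ) (i : ℕ) (l : Fin (F.rank i)) :
    ∃ l', G.deg i l' = F.deg i l := by
  obtain ⟨α, hα⟩ := exists_graded_comparison hπ F G
  obtain ⟨β, -⟩ := exists_graded_comparison hπ G F
  by_contra! h
  refine single_one_notMem_smul_top (irrelevantIdeal_ne_top 𝒜) l ?_
  have h1 : α.map i (Pi.single l 1) ∈ irrelevantIdeal 𝒜 • (⊤ : Submodule A _) := by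
    rw [mem_smul_top_pi_iff]
    intro j
    exact mem_irrelevantIdeal_of_mem_extendToInt 𝒜 (sub_ne_zero.2 (h j).symm)
      ((mem_gradedFreeComponent_iff 𝒜 _).1 (hα i l) j)
  have h2 := sub_mem (map_mem_smul_top _ (β.map i) h1) (α.comp_sub_mem β i (Pi.single l 1))
  simpa using h2

theorem IsPure.of_isPure [Nontrivial A] {π : ℤ → M →+ M} (hπ : IsGradedProjection ℳ π)
    {F : MinimalGradedFreeResolution 𝒜 ℳ} (hF : F.IsPure) (G : MinimalGradedFreeResolution 𝒜 ℳ) :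
    G.IsPure := by
  rw [isPure_iff] at hF ⊢
  intro i l l'
  obtain ⟨j, hj⟩ := exists_deg_eq hπ G F i l
  obtain ⟨j', hj'⟩ := exists_deg_eq hπ G F i l'
  rw [← hj, ← hj', hF]

/-- The entries of the matrices of a minimal graded resolution have positive degree. -/
theorem deg_lt_of_isPure [Nontrivial A] {F : MinimalGradedFreeResolution 𝒜 ℳ} (hF : F.IsPure)
    (i : ℕ) (l : Fin (F.rank (i + 1))) (j : Fin (F.rank i)) : F.deg i j < F.deg (i + 1) l := by
  by_contra! h
  rw [isPure_iff] at hF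
  refine single_one_notMem_smul_top (irrelevantIdeal_ne_top 𝒜) l (F.minimal_d i ?_)
  rw [LinearMap.mem_ker]
  ext j'
  rw [← hF i j' j] at h
  have h1 := (mem_gradedFreeComponent_iff 𝒜 _).1
    (F.d_graded i _ _ (single_one_mem_gradedFreeComponent 𝒜 _ l)) j'
  have h2 := (mem_smul_top_pi_iff _ _).1 (F.d_mem i (Pi.single l 1)) j'
  rcases h.lt_or_eq with h | h
  · rw [extendToInt_of_neg _ (sub_neg.2 h)] at h1
    exact h1
  · rw [h, sub_self] at h1
    exact eq_zero_of_mem_irrelevantIdeal 𝒜 h2 h1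

/-- The entries of the matrices of a pure resolution. -/
theorem IsPure.exists_shift [Nontrivial A] {F : MinimalGradedFreeResolution 𝒜 ℳ} (hF : F.IsPure) :
    ∃ e : ℕ → ℕ, ∀ i, 1 ≤ e i ∧ (∀ l j, F.deg (i + 1) l = F.deg i j + e i) ∧
      (F.rank (i + 1) = 0 → e i = 1) := by
  have h (i : ℕ) : ∃ e : ℕ, 1 ≤ e ∧ (∀ l j, F.deg (i + 1) l = F.deg i j + e) ∧
      (F.rank (i + 1) = 0 → e = 1) := by
    rcases Nat.eq_zero_or_pos (F.rank (i + 1)) with h1 | h1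
    -- Next to a zero module the shift is unconstrained; the value 1 keeps the shifts equal to 1
    -- after the resolution has ended.
    · exact ⟨1, le_rfl, fun l => by rw [h1] at l; exact l.elim0, fun _ => rfl⟩
    rcases Nat.eq_zero_or_pos (F.rank i) with h0 | h0
    · exact ⟨1, le_rfl, fun _ j => by rw [h0] at j; exact j.elim0, fun _ => rfl⟩
    have hlt := deg_lt_of_isPure hF i ⟨0, h1⟩ ⟨0, h0⟩
    rw [isPure_iff] at hF
    refine ⟨(F.deg (i + 1) ⟨0, h1⟩ - F.deg i ⟨0, h0⟩).toNat, by omega, fun l j => ?_, by omega⟩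
    rw [hF i j ⟨0, h0⟩, hF (i + 1) l ⟨0, h1⟩]
    omega
  choose e he using h
  exact ⟨e, he⟩

theorem d_single_mem {F : MinimalGradedFreeResolution 𝒜 ℳ} {i e : ℕ}
    {l : Fin (F.rank (i + 1))} {j : Fin (F.rank i)} (h : F.deg (i + 1) l = F.deg i j + e) :
    F.d i (Pi.single l 1) j ∈ 𝒜 e := by
  have := (mem_gradedFreeComponent_iff 𝒜 _).1
    (F.d_graded i _ _ (single_one_mem_gradedFreeComponent 𝒜 _ l)) j
  rwa [h, add_sub_cancel_left, extendToInt_natCast] at this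

/-! ### Shifts equal to one from the second syzygy on. -/

/-- If the irrelevant ideal is `I ⊕ J`, then the second and the higher syzygy modules are the
direct sums of their submodules with coordinates in `I` and in `J`. -/
theorem exists_split_d (F : MinimalFreeResolution (irrelevantIdeal 𝒜) M) {I J : Ideal A}
    (hIJ : irrelevantIdeal 𝒜 ≤ I ⊔ J) (hdisj : Disjoint I J) (i : ℕ)
    (v : Fin (F.rank (i + 2)) → A) :
    ∃ f g, F.d (i + 1) f + F.d (i + 1) g = F.d (i + 1) v ∧ (∀ l, F.d (i + 1) f l ∈ I) ∧
      ∀ l, F.d (i + 1) g l ∈ J := by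
  have h1 (l) : ∃ y ∈ I, ∃ z ∈ J, y + z = F.d (i + 1) v l :=
    Submodule.mem_sup.1 (hIJ ((mem_smul_top_pi_iff _ _).1 (F.d_mem (i + 1) v) l))
  choose y hy z hz hyz using h1
  have hyz' : y + z = F.d (i + 1) v := funext hyz
  -- The target must be a free module for the two images to have entries in `I` and in `J`. The
  -- augmentation has no such target, so the splitting starts at the second syzygy and not at the
  -- first.
  have hker : F.d i y = 0 ∧ F.d i z = 0 := by
    have hy' := map_mem_smul_top I (F.d i) ((mem_smul_top_pi_iff _ _).2 hy)
    have hz' := map_mem_smul_top J (F.d i) ((mem_smul_top_pi_iff _ _).2 hz)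
    rw [mem_smul_top_pi_iff] at hy' hz'
    have hsum : F.d i y + F.d i z = 0 := by rw [← map_add, hyz', F.d_d]
    have hy0 : F.d i y = 0 := by
      ext l
      refine Submodule.disjoint_def.1 hdisj _ (hy' l) ?_
      rw [eq_neg_of_add_eq_zero_left hsum]
      exact J.neg_mem (hz' l)
    exact ⟨hy0, by rwa [hy0, zero_add] at hsum⟩
  obtain ⟨f, hf⟩ := (F.exact_d i _).1 hker.1
  obtain ⟨g, hg⟩ := (F.exact_d i _).1 hker.2
  exact ⟨f, g, by rw [hf, hg, hyz'], by rwa [hf], by rwa [hg]⟩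

/-- Since `b` annihilates `I`, the vector `b • f` is a relation. Some entry of `f` has nonzero part
in degree 0, so `b • f` has nonzero part in degree 1. Columns of degree `e > 1` cannot produce it,
nor can an empty set of columns. -/
theorem exists_shift_eq_one {F : MinimalGradedFreeResolution 𝒜 ℳ} {I J : Ideal A}
    (hdisj : Disjoint I J) {b : A} (hb : b ∈ J) (hb1 : b ∈ 𝒜 1)
    (hreg : ∀ c ∈ 𝒜 0, b * c = 0 → c = 0) {i e : ℕ} {f : Fin (F.rank (i + 1)) → A}
    (hf : f ∉ irrelevantIdeal 𝒜 • (⊤ : Submodule A (Fin (F.rank (i + 1)) → A)))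
    (hfI : ∀ l, F.d i f l ∈ I) (he1 : 1 ≤ e)
    (he : ∀ l j, F.deg (i + 1 + 1) l = F.deg (i + 1) j + e) :
    e = 1 ∧ F.rank (i + 2) ≠ 0 := by
  have hker : F.d i (b • f) = 0 := by
    ext l
    rw [map_smul]
    exact Submodule.disjoint_def.1 hdisj _ (I.mul_mem_left b (hfI l)) (J.mul_mem_right _ hb)
  obtain ⟨w, hw⟩ := (F.exact_d i _).1 hker
  rw [mem_smul_top_pi_iff] at hf
  push Not at hf
  obtain ⟨j, hj⟩ := hf
  have hne : GradedRing.proj 𝒜 (1 + 0) (b * f j) ≠ 0 := by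
    rw [GradedRing.proj_apply, coe_decompose_mul_add_of_left_mem 𝒜 hb1]
    intro h
    exact hj ((HomogeneousIdeal.mem_irrelevant_iff 𝒜 _).2 (hreg _ (SetLike.coe_mem _) h))
  have hexp : b * f j = ∑ l, w l * F.d (i + 1) (Pi.single l 1) j := by
    have := congrFun hw j
    rw [map_eq_sum_smul] at this
    simpa using this.symm
  constructor
  · by_contra h
    refine hne ?_
    rw [hexp, map_sum]
    refine Finset.sum_eq_zero fun l _ => ?_
    exact coe_decompose_mul_of_right_mem_of_not_le 𝒜 (d_single_mem (he l j)) (by omega)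
  · intro h
    refine hne ?_
    rw [hexp]
    have : IsEmpty (Fin (F.rank (i + 1 + 1))) := by
      change F.rank (i + 1 + 1) = 0 at h
      rw [h]; infer_instance
    simp

/-- The hypotheses on the graded ring `A` that make pure resolutions linear from the second syzygy
on: the irrelevant ideal is a direct sum of two ideals, and each of them has an element of degree
`1` that no nonzero element of degree `0` annihilates. -/
structure _root_.IrrelevantIdealSplits (𝒜 : ℕ → AddSubgroup A) [GradedRing 𝒜]
    (I J : Ideal A) : Prop where
  le_sup : irrelevantIdeal 𝒜 ≤ I ⊔ J
  disjoint : Disjoint I J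
  left : ∃ b ∈ I, b ∈ 𝒜 1 ∧ ∀ c ∈ 𝒜 0, b * c = 0 → c = 0
  right : ∃ b ∈ J, b ∈ 𝒜 1 ∧ ∀ c ∈ 𝒜 0, b * c = 0 → c = 0

theorem shift_eq_one [Nontrivial A] {F : MinimalGradedFreeResolution 𝒜 ℳ} {I J : Ideal A}
    (hs : IrrelevantIdealSplits 𝒜 I J) {i e : ℕ} (hr : F.rank (i + 2) ≠ 0) (he1 : 1 ≤ e)
    (he : ∀ l j, F.deg (i + 2 + 1) l = F.deg (i + 2) j + e) :
    e = 1 ∧ F.rank (i + 3) ≠ 0 := by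
  obtain ⟨b, hbJ, hb1, hb⟩ := hs.right
  obtain ⟨a, haI, ha1, ha⟩ := hs.left
  let l : Fin (F.rank (i + 2)) := ⟨0, Nat.pos_of_ne_zero hr⟩
  obtain ⟨f, g, hfg, hf, hg⟩ := exists_split_d F.toMinimalFreeResolution hs.le_sup hs.disjoint i
    (Pi.single l 1)
  -- The basis vector is congruent to `f + g` modulo `A_+` by minimality, so `f` and `g` are not
  -- both zero modulo `A_+`. The two cases exchange the roles of `I` and `J`.
  by_cases hfm : f ∈ irrelevantIdeal 𝒜 • (⊤ : Submodule A (Fin (F.rank (i + 2)) → A))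
  · refine exists_shift_eq_one hs.disjoint.symm haI ha1 ha (f := g) (fun hgm => ?_) hg he1 he
    refine single_one_notMem_smul_top (irrelevantIdeal_ne_top 𝒜) l ?_
    have h : Pi.single l 1 - (f + g) ∈ LinearMap.ker (F.d (i + 1)) := by
      rw [LinearMap.mem_ker, map_sub, map_add, hfg, sub_self]
    simpa using add_mem (F.minimal_d (i + 1) h) (add_mem hfm hgm)
  · exact exists_shift_eq_one hs.disjoint hbJ hb1 hb hfm hf he1 he

/-- Each step produces a nonzero relation, so a resolution that reaches `F_2 ≠ 0` never stops. -/
theorem rank_ne_zero [Nontrivial A] {F : MinimalGradedFreeResolution 𝒜 ℳ} (hF : F.IsPure)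
    {I J : Ideal A} (hs : IrrelevantIdealSplits 𝒜 I J) (h2 : F.rank 2 ≠ 0) (i : ℕ) :
    F.rank (i + 2) ≠ 0 := by
  obtain ⟨e, he⟩ := hF.exists_shift
  induction i with
  | zero => exact h2
  | succ i ih => exact (shift_eq_one hs ih (he (i + 2)).1 (he (i + 2)).2.1).2

theorem rank_eq_zero [Nontrivial A] {F : MinimalGradedFreeResolution 𝒜 ℳ} (h2 : F.rank 2 = 0)
    (i : ℕ) : F.rank (i + 2) = 0 := by
  induction i with
  | zero => exact h2
  | succ i ih => exact F.rank_succ_eq_zero (irrelevantIdeal_ne_top 𝒜) ih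

theorem IsPure.exists_shift_eventually_one [Nontrivial A] {F : MinimalGradedFreeResolution 𝒜 ℳ}
    (hF : F.IsPure) {I J : Ideal A} (hs : IrrelevantIdealSplits 𝒜 I J) :
    ∃ e : ℕ → ℕ, ∀ i, 1 ≤ e i ∧ (∀ l j, F.deg (i + 1) l = F.deg i j + e i) ∧ e (i + 2) = 1 := by
  obtain ⟨e, he⟩ := hF.exists_shift
  refine ⟨e, fun i => ⟨(he i).1, (he i).2.1, ?_⟩⟩
  by_cases h2 : F.rank 2 = 0
  · exact (he _).2.2 (rank_eq_zero h2 (i + 1))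
  · exact (shift_eq_one hs (rank_ne_zero hF hs h2 i) (he (i + 2)).1 (he (i + 2)).2.1).1

/-- The truncation of a minimal graded resolution at a syzygy module. -/
def truncate (F : MinimalGradedFreeResolution 𝒜 ℳ) (i : ℕ) :
    MinimalGradedFreeResolution 𝒜 (F.syzygySuccComponent (i + 1)) where
  rank j := F.rank (i + 2 + j)
  aug := (F.d (i + 1)).codRestrict _ fun x => LinearMap.mem_ker.2 (F.d_d i x)
  d j := F.d (i + 2 + j)
  aug_surjective y := by
    obtain ⟨x, hx⟩ := (F.exact_d i _).1 y.2
    exact ⟨x, Subtype.ext hx⟩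
  exact_aug x := by
    rw [← F.exact_d (i + 1) x, ← Subtype.coe_inj]
    rfl
  exact_d j := F.exact_d (i + 2 + j)
  minimal_aug := by
    intro x hx
    exact F.minimal_d (i + 1) (congrArg Subtype.val (LinearMap.mem_ker.1 hx))
  minimal_d j := F.minimal_d (i + 2 + j)
  deg j := F.deg (i + 2 + j)
  aug_graded n x hx := F.d_graded (i + 1) n x hx
  d_graded j n x hx := F.d_graded (i + 2 + j) n x hx

/-- Over a graded ring whose irrelevant ideal splits, the second syzygy module of a module with a
pure resolution has a linear resolution. -/
theorem IsPure.hasLinearResolution_syzygySucc_one [Nontrivial A]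
    {F : MinimalGradedFreeResolution 𝒜 ℳ} (hF : F.IsPure) {I J : Ideal A}
    (hs : IrrelevantIdealSplits 𝒜 I J) : HasLinearResolution 𝒜 (F.syzygySuccComponent 1) := by
  obtain ⟨e, he⟩ := hF.exists_shift_eventually_one hs
  refine ⟨F.truncate 0, (isLinear_iff _).2 ?_⟩
  by_cases h2 : F.rank 2 = 0
  · refine ⟨0, fun i l => ?_⟩
    have l' : Fin (F.rank (0 + 2 + i)) := l
    rw [add_comm, zero_add, rank_eq_zero h2] at l'
    exact l'.elim0
  · refine ⟨F.deg 2 ⟨0, Nat.pos_of_ne_zero h2⟩, fun i => ?_⟩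
    change ∀ l : Fin (F.rank (2 + i)), F.deg (2 + i) l = _
    rw [add_comm 2 i]
    induction i with
    | zero => intro l; rw [(isPure_iff F).1 hF 2 l ⟨0, Nat.pos_of_ne_zero h2⟩]; simp
    | succ i ih =>
      intro l
      have := (he (i + 2)).2.1 l ⟨0, Nat.pos_of_ne_zero (rank_ne_zero hF hs h2 i)⟩
      rw [ih, (he i).2.2] at this
      change F.deg (i + 2 + 1) l = _
      rw [this]
      push_cast
      ring

end MinimalGradedFreeResolution

/-! ### Symbols in associated graded rings and modules -/

section Symbols

variable {R : Type*} [CommRing R] (I : Ideal R) {M : Type*} [AddCommGroup M] [Module R M]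

/-- The class of `r` in `I ^ n / I ^ (n + 1)`, for `r ∈ I ^ n`. -/
def AssocGradedRing.symbol (n : ℕ) (r : R) : AssocGradedRing I :=
  open Classical in
  -- The default `0` makes the symbol total, so symbols of vectors can be taken coordinatewise
  -- without membership proofs.
  if h : r ∈ I ^ n • (⊤ : Submodule R R) then AssocGradedRing.of I n (GrPiece.mk I r h) else 0

/-- The class of `x` in `I ^ n M / I ^ (n + 1) M`, for `x ∈ I ^ n M`. -/
def AssocGradedModule.symbol (n : ℕ) (x : M) : AssocGradedModule I M :=
  open Classical in
  if h : x ∈ I ^ n • (⊤ : Submodule R M) then AssocGradedModule.of I M n (GrPiece.mk I x h) else 0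

theorem GrPiece.mk_eq_zero_iff {n : ℕ} {x : M} (hx : x ∈ I ^ n • (⊤ : Submodule R M)) :
    GrPiece.mk I x hx = 0 ↔ x ∈ I ^ (n + 1) • (⊤ : Submodule R M) :=
  Submodule.Quotient.mk_eq_zero _

theorem GrPiece.mk_add {n : ℕ} {x y : M} (hx : x ∈ I ^ n • (⊤ : Submodule R M))
    (hy : y ∈ I ^ n • (⊤ : Submodule R M)) :
    GrPiece.mk I (x + y) (add_mem hx hy) = GrPiece.mk I x hx + GrPiece.mk I y hy := rfl

theorem mem_pow_smul_top_self {n : ℕ} {r : R} : r ∈ I ^ n • (⊤ : Submodule R R) ↔ r ∈ I ^ n := by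
  rw [smul_eq_mul, Ideal.mul_top]

theorem mem_pow_zero_smul_top (x : M) : x ∈ I ^ 0 • (⊤ : Submodule R M) := by
  rw [pow_zero, one_smul]
  trivial

theorem AssocGradedRing.symbol_of_mem {n : ℕ} {r : R} (h : r ∈ I ^ n • (⊤ : Submodule R R)) :
    symbol I n r = of I n (GrPiece.mk I r h) := dif_pos h

theorem AssocGradedModule.symbol_of_mem {n : ℕ} {x : M} (h : x ∈ I ^ n • (⊤ : Submodule R M)) :
    symbol I n x = of I M n (GrPiece.mk I x h) := dif_pos h

theorem AssocGradedRing.symbol_mem (n : ℕ) (r : R) : symbol I n r ∈ component I n := by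
  rw [symbol]
  split_ifs
  · exact ⟨_, rfl⟩
  · exact zero_mem _

theorem AssocGradedModule.symbol_mem (n : ℕ) (x : M) : symbol I n x ∈ component I M n := by
  rw [symbol]
  split_ifs
  · exact ⟨_, rfl⟩
  · exact zero_mem _

theorem AssocGradedRing.exists_symbol_eq {n : ℕ} {z : AssocGradedRing I}
    (hz : z ∈ component I n) : ∃ r ∈ I ^ n, symbol I n r = z := by
  obtain ⟨y, rfl⟩ := hz
  obtain ⟨r, hr, rfl⟩ := GrPiece.mk_surj y
  exact ⟨r, (mem_pow_smul_top_self I).1 hr, symbol_of_mem I hr⟩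

theorem AssocGradedModule.exists_symbol_eq {n : ℕ} {z : AssocGradedModule I M}
    (hz : z ∈ component I M n) : ∃ x ∈ I ^ n • (⊤ : Submodule R M), symbol I n x = z := by
  obtain ⟨y, rfl⟩ := hz
  obtain ⟨x, hx, rfl⟩ := GrPiece.mk_surj y
  exact ⟨x, hx, symbol_of_mem I hx⟩

/-- A family of maps that behaves like `x ↦ x + I ^ (n + 1) N` on the submodules `I ^ n N`. -/
structure IsSymbol {N V : Type*} [AddCommGroup N] [Module R N] [AddCommGroup V]
    [Module (AssocGradedRing I) V] (σ : ℕ → N → V) : Prop where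
  eq_zero_iff {n : ℕ} {x : N} : x ∈ I ^ n • (⊤ : Submodule R N) →
    (σ n x = 0 ↔ x ∈ I ^ (n + 1) • (⊤ : Submodule R N))
  add {n : ℕ} {x y : N} : x ∈ I ^ n • (⊤ : Submodule R N) → y ∈ I ^ n • (⊤ : Submodule R N) →
    σ n (x + y) = σ n x + σ n y
  smul {k n : ℕ} {r : R} {x : N} : r ∈ I ^ k → x ∈ I ^ n • (⊤ : Submodule R N) →
    σ (k + n) (r • x) = AssocGradedRing.symbol I k r • σ n x

theorem AssocGradedModule.isSymbol : IsSymbol I (AssocGradedModule.symbol I (M := M)) where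
  eq_zero_iff {n x} h := by
    rw [symbol_of_mem I h, ← GrPiece.mk_eq_zero_iff I h]
    exact map_eq_zero_iff _ (DirectSum.of_injective n)
  add {n x y} hx hy := by
    rw [symbol_of_mem I hx, symbol_of_mem I hy, symbol_of_mem I (add_mem hx hy), ← map_add,
      GrPiece.mk_add]
  smul {k n r x} hr hx := by
    have hr' := (mem_pow_smul_top_self I).2 hr
    rw [symbol_of_mem I hx, AssocGradedRing.symbol_of_mem I hr',
      symbol_of_mem I (GrPiece.smul_mem hr' hx)]
    exact (DirectSum.Gmodule.of_smul_of (GrPiece I R) (GrPiece I M) (GrPiece.mk I r hr')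
      (GrPiece.mk I x hx)).symm

theorem AssocGradedRing.isSymbol : IsSymbol I (AssocGradedRing.symbol I) where
  eq_zero_iff {n x} h := by
    rw [symbol_of_mem I h, ← GrPiece.mk_eq_zero_iff I h]
    exact map_eq_zero_iff _ (DirectSum.of_injective n)
  add {n x y} hx hy := by
    rw [symbol_of_mem I hx, symbol_of_mem I hy, symbol_of_mem I (add_mem hx hy), ← map_add,
      GrPiece.mk_add]
  smul {k n r x} hr hx := by
    have hr' := (mem_pow_smul_top_self I).2 hr
    rw [symbol_of_mem I hx, AssocGradedRing.symbol_of_mem I hr',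
      symbol_of_mem I (GrPiece.smul_mem hr' hx)]
    exact (DirectSum.of_mul_of (A := GrPiece I R) (GrPiece.mk I r hr') (GrPiece.mk I x hx)).symm

theorem mem_pow_smul_top_pi_iff {b n : ℕ} {u : Fin b → R} :
    u ∈ I ^ n • (⊤ : Submodule R (Fin b → R)) ↔ ∀ l, u l ∈ I ^ n :=
  mem_smul_top_pi_iff _ _

/-- The coordinatewise symbol of a vector. -/
def vectorSymbol {b : ℕ} (n : ℕ) (u : Fin b → R) : Fin b → AssocGradedRing I :=
  fun l => AssocGradedRing.symbol I n (u l)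

theorem isSymbol_vectorSymbol (b : ℕ) : IsSymbol I (vectorSymbol I (b := b)) where
  eq_zero_iff {n x} h := by
    rw [mem_pow_smul_top_pi_iff] at h ⊢
    rw [funext_iff]
    refine forall_congr' fun l => ?_
    rw [← mem_pow_smul_top_self]
    exact (AssocGradedRing.isSymbol I).eq_zero_iff ((mem_pow_smul_top_self I).2 (h l))
  add {n x y} hx hy := by
    rw [mem_pow_smul_top_pi_iff] at hx hy
    ext l : 1
    exact (AssocGradedRing.isSymbol I).add ((mem_pow_smul_top_self I).2 (hx l))
      ((mem_pow_smul_top_self I).2 (hy l))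
  smul {k n r x} hr hx := by
    rw [mem_pow_smul_top_pi_iff] at hx
    ext l : 1
    exact (AssocGradedRing.isSymbol I).smul hr ((mem_pow_smul_top_self I).2 (hx l))

theorem exists_vectorSymbol_eq {b n : ℕ} {z : Fin b → AssocGradedRing I}
    (hz : ∀ l, z l ∈ AssocGradedRing.component I n) :
    ∃ u ∈ I ^ n • (⊤ : Submodule R (Fin b → R)), vectorSymbol I n u = z := by
  choose u hu huz using fun l => AssocGradedRing.exists_symbol_eq I (hz l)
  exact ⟨u, (mem_pow_smul_top_pi_iff I).2 hu, funext huz⟩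

namespace IsSymbol

variable {I} {N V : Type*} [AddCommGroup N] [Module R N] [AddCommGroup V]
  [Module (AssocGradedRing I) V] {σ : ℕ → N → V}

theorem zero (hσ : IsSymbol I σ) (n : ℕ) : σ n 0 = 0 :=
  (hσ.eq_zero_iff (zero_mem _)).2 (zero_mem _)

theorem sub (hσ : IsSymbol I σ) {n : ℕ} {x y : N} (hx : x ∈ I ^ n • (⊤ : Submodule R N))
    (hy : y ∈ I ^ n • (⊤ : Submodule R N)) : σ n (x - y) = σ n x - σ n y := by
  rw [eq_sub_iff_add_eq, ← hσ.add (sub_mem hx hy) hy, sub_add_cancel]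

theorem sub_mem_succ (hσ : IsSymbol I σ) {n : ℕ} {x y : N}
    (hx : x ∈ I ^ n • (⊤ : Submodule R N)) (hy : y ∈ I ^ n • (⊤ : Submodule R N))
    (h : σ n x = σ n y) : x - y ∈ I ^ (n + 1) • (⊤ : Submodule R N) := by
  rw [← hσ.eq_zero_iff (sub_mem hx hy), hσ.sub hx hy, h, sub_self]

theorem sum (hσ : IsSymbol I σ) {n : ℕ} {ι : Type*} (s : Finset ι) (f : ι → N)
    (hf : ∀ i, f i ∈ I ^ n • (⊤ : Submodule R N)) : σ n (∑ i ∈ s, f i) = ∑ i ∈ s, σ n (f i) := by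
  classical
  induction s using Finset.induction_on with
  | empty => simp [hσ.zero]
  | insert a s ha ih =>
    rw [Finset.sum_insert ha, Finset.sum_insert ha, hσ.add (hf a) (sum_mem fun i _ => hf i), ih]

theorem map_mem {b e : ℕ} {φ : (Fin b → R) →ₗ[R] N}
    (hφ : ∀ l, φ (Pi.single l 1) ∈ I ^ e • (⊤ : Submodule R N)) {k : ℕ} {u : Fin b → R}
    (hu : u ∈ I ^ k • (⊤ : Submodule R (Fin b → R))) :
    φ u ∈ I ^ (k + e) • (⊤ : Submodule R N) := by
  rw [map_eq_sum_smul]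
  refine sum_mem fun l _ => GrPiece.smul_mem ?_ (hφ l)
  exact (mem_pow_smul_top_self I).2 ((mem_pow_smul_top_pi_iff I).1 hu l)

/-- Symbols are compatible with a map and the induced map of graded modules. -/
theorem map_vectorSymbol (hσ : IsSymbol I σ) {b e : ℕ} {φ : (Fin b → R) →ₗ[R] N}
    {ψ : (Fin b → AssocGradedRing I) →ₗ[AssocGradedRing I] V}
    (hφ : ∀ l, φ (Pi.single l 1) ∈ I ^ e • (⊤ : Submodule R N))
    (hψ : ∀ l, ψ (Pi.single l 1) = σ e (φ (Pi.single l 1))) {k : ℕ} {u : Fin b → R}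
    (hu : u ∈ I ^ k • (⊤ : Submodule R (Fin b → R))) :
    ψ (vectorSymbol I k u) = σ (k + e) (φ u) := by
  rw [mem_pow_smul_top_pi_iff] at hu
  rw [map_eq_sum_smul ψ, map_eq_sum_smul φ, hσ.sum]
  · refine Finset.sum_congr rfl fun l _ => ?_
    rw [hσ.smul (hu l) (hφ l), hψ]
    rfl
  · exact fun l => GrPiece.smul_mem ((mem_pow_smul_top_self I).2 (hu l)) (hφ l)

end IsSymbol

variable {I} in
theorem adicOrder_eq_one {N : Type*} [AddCommGroup N] [Module R N] {x : N}
    (h1 : x ∈ I • (⊤ : Submodule R N)) (h2 : x ∉ I ^ 2 • (⊤ : Submodule R N)) :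
    adicOrder I x = 1 := by
  have hmem : 1 ∈ {i : ℕ | x ∈ I ^ i • (⊤ : Submodule R N) ∧
      x ∉ I ^ (i + 1) • (⊤ : Submodule R N)} := ⟨by rwa [pow_one], h2⟩
  refine le_antisymm (Nat.sInf_le hmem) ?_
  rw [Nat.one_le_iff_ne_zero]
  intro h0
  have := Nat.sInf_mem ⟨_, hmem⟩
  rw [← adicOrder, h0] at this
  exact this.2 (by rwa [zero_add, pow_one])

end Symbols

/-! ### Lifting a pure resolution of the associated graded module -/

section Lifting

variable {R : Type*} [CommRing R] [IsLocalRing R]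

instance : Nontrivial (AssocGradedRing (maximalIdeal R)) := by
  refine ⟨AssocGradedRing.symbol _ 0 (1 : R), 0, fun h => ?_⟩
  rw [(AssocGradedRing.isSymbol _).eq_zero_iff (by simp), mem_pow_smul_top_self, zero_add,
    pow_one] at h
  exact (maximalIdeal.isMaximal R).ne_top ((Ideal.eq_top_iff_one _).2 h)

/-- Krull's intersection theorem for `N ⧸ L`: submodules of `N` are closed in the adic topology. -/
theorem mem_of_forall_exists_sub_mem_pow_smul_top [IsNoetherianRing R] {N : Type*} [AddCommGroup N]
    [Module R N] [Module.Finite R N] (L : Submodule R N) {x : N}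
    (h : ∀ j, ∃ y ∈ L, x - y ∈ maximalIdeal R ^ j • (⊤ : Submodule R N)) : x ∈ L := by
  rw [← Submodule.Quotient.mk_eq_zero, ← Submodule.mem_bot R,
    ← Ideal.iInf_pow_smul_eq_bot_of_isLocalRing (M := N ⧸ L) (maximalIdeal R)
      (maximalIdeal.isMaximal R).ne_top, Submodule.mem_iInf]
  intro j
  obtain ⟨y, hy, hxy⟩ := h j
  have := map_mem_smul_top (maximalIdeal R ^ j) L.mkQ hxy
  rwa [map_sub, Submodule.mkQ_apply, Submodule.mkQ_apply, (Submodule.Quotient.mk_eq_zero L).2 hy,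
    sub_zero] at this

local notation "𝔪" => maximalIdeal R

/-- Elements of `K ∩ 𝔪 ^ n N` are values of `φ` on `𝔪 ^ (n - e)` if this is so for symbols. -/
theorem exists_map_eq_of_symbol [IsNoetherianRing R] {N V : Type*} [AddCommGroup N]
    [Module R N] [Module.Finite R N] [AddCommGroup V] [Module (AssocGradedRing 𝔪) V]
    {σ : ℕ → N → V} (hσ : IsSymbol 𝔪 σ) (K : Submodule R N) {b e : ℕ}
    {φ : (Fin b → R) →ₗ[R] N} (hK : ∀ u, φ u ∈ K)
    {ψ : (Fin b → AssocGradedRing 𝔪) →ₗ[AssocGradedRing 𝔪] V}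
    (hφ : ∀ l, φ (Pi.single l 1) ∈ 𝔪 ^ e • (⊤ : Submodule R N))
    (hψ : ∀ l, ψ (Pi.single l 1) = σ e (φ (Pi.single l 1)))
    (hlt : ∀ n < e, ∀ x ∈ K, x ∈ 𝔪 ^ n • (⊤ : Submodule R N) →
      x ∈ 𝔪 ^ (n + 1) • (⊤ : Submodule R N))
    (hle : ∀ k, ∀ x ∈ K, x ∈ 𝔪 ^ (k + e) • (⊤ : Submodule R N) →
      ∃ z, (∀ l, z l ∈ AssocGradedRing.component 𝔪 k) ∧ ψ z = σ (k + e) x)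
    {n : ℕ} {x : N} (hxK : x ∈ K) (hx : x ∈ 𝔪 ^ n • (⊤ : Submodule R N)) :
    ∃ u ∈ 𝔪 ^ (n - e) • (⊤ : Submodule R (Fin b → R)), φ u = x := by
  -- The subtraction is truncated: for `n ≤ e` this is the whole image of `φ`.
  let L (n : ℕ) : Submodule R N := (𝔪 ^ (n - e) • (⊤ : Submodule R (Fin b → R))).map φ
  have hL (j : ℕ) : L (n + j) ≤ L n :=
    Submodule.map_mono (Submodule.smul_mono_left (Ideal.pow_le_pow_right (by omega)))
  have hLK (n : ℕ) : L n ≤ K := by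
    rintro _ ⟨u, -, rfl⟩
    exact hK u
  have step (n : ℕ) (x : N) (hxK : x ∈ K) (hx : x ∈ 𝔪 ^ n • (⊤ : Submodule R N)) :
      ∃ y ∈ L n, x - y ∈ 𝔪 ^ (n + 1) • (⊤ : Submodule R N) := by
    -- Below degree `e` the symbol already vanishes and no correction is needed; from `e` on, a lift
    -- of the symbol's preimage is subtracted.
    rcases lt_or_ge n e with hn | hn
    · exact ⟨0, zero_mem _, by rw [sub_zero]; exact hlt n hn x hxK hx⟩
    · obtain ⟨k, rfl⟩ := Nat.exists_eq_add_of_le' hn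
      obtain ⟨z, hz, hzx⟩ := hle k x hxK hx
      obtain ⟨u, hu, rfl⟩ := exists_vectorSymbol_eq 𝔪 hz
      refine ⟨φ u, ⟨u, by rwa [Nat.add_sub_cancel], rfl⟩,
        hσ.sub_mem_succ hx (IsSymbol.map_mem hφ hu) ?_⟩
      rw [← hzx, hσ.map_vectorSymbol hφ hψ hu]
  -- Successive approximation: all corrections stay in `L n`, because `L` is decreasing, and `L n`
  -- is closed.
  suffices h : x ∈ L n from h
  refine mem_of_forall_exists_sub_mem_pow_smul_top _ fun j => ?_
  suffices h : ∃ y ∈ L n, x - y ∈ 𝔪 ^ (n + j) • (⊤ : Submodule R N) from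
    h.imp fun y hy => ⟨hy.1, Submodule.smul_mono_left (Ideal.pow_le_pow_right (by omega)) hy.2⟩
  induction j with
  | zero => exact ⟨0, zero_mem _, by simpa using hx⟩
  | succ j ih =>
    obtain ⟨y, hy, hxy⟩ := ih
    obtain ⟨y', hy', h⟩ := step _ _ (sub_mem hxK (hLK _ hy)) hxy
    exact ⟨y + y', add_mem hy (hL j hy'), by rwa [← sub_sub, ← add_assoc]⟩

/-- The map `φ` lifts the map `ψ` of graded modules, which is homogeneous of degree `e`, and is
strict for the adic filtrations. -/
structure IsStrictLift {N V : Type*} [AddCommGroup N] [Module R N] [AddCommGroup V]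
    [Module (AssocGradedRing 𝔪) V] (σ : ℕ → N → V) {b : ℕ} (e : ℕ) (φ : (Fin b → R) →ₗ[R] N)
    (ψ : (Fin b → AssocGradedRing 𝔪) →ₗ[AssocGradedRing 𝔪] V) : Prop where
  map_single_mem (l) : φ (Pi.single l 1) ∈ 𝔪 ^ e • (⊤ : Submodule R N)
  map_single (l) : ψ (Pi.single l 1) = σ e (φ (Pi.single l 1))
  strict {k : ℕ} {u : Fin b → R} : φ u ∈ 𝔪 ^ (k + e) • (⊤ : Submodule R N) →
    ∃ u' ∈ 𝔪 ^ k • (⊤ : Submodule R (Fin b → R)), φ u' = φ u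

/-- Lift a column of `ψ'` to a vector `u`. As `ψ ∘ ψ' = 0`, the symbol of `φ u` vanishes and `φ u`
lies one step deeper in the filtration; strictness of `φ` then corrects `u` into the kernel without
changing its symbol. The final filtered clause yields both exactness and the strictness of `φ'`. -/
theorem IsStrictLift.exists_next [IsNoetherianRing R] {N V : Type*} [AddCommGroup N]
    [Module R N] [AddCommGroup V] [Module (AssocGradedRing 𝔪) V]
    {σ : ℕ → N → V} (hσ : IsSymbol 𝔪 σ) {b c e e' : ℕ} {φ : (Fin b → R) →ₗ[R] N}
    {ψ : (Fin b → AssocGradedRing 𝔪) →ₗ[AssocGradedRing 𝔪] V} (h : IsStrictLift σ e φ ψ)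
    {ψ' : (Fin c → AssocGradedRing 𝔪) →ₗ[AssocGradedRing 𝔪] (Fin b → AssocGradedRing 𝔪)}
    (hψ' : ∀ l j, ψ' (Pi.single l 1) j ∈ AssocGradedRing.component 𝔪 e')
    (hex : Function.Exact ψ' ψ) :
    ∃ φ' : (Fin c → R) →ₗ[R] (Fin b → R), IsStrictLift (vectorSymbol 𝔪) e' φ' ψ' ∧
      (∀ x, φ (φ' x) = 0) ∧ ∀ {n : ℕ} {x}, φ x = 0 → x ∈ 𝔪 ^ n • (⊤ : Submodule R (Fin b → R)) →
        ∃ u ∈ 𝔪 ^ (n - e') • (⊤ : Submodule R (Fin c → R)), φ' u = x := by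
  have hS := isSymbol_vectorSymbol 𝔪 b
  have h1 (l) : ∃ y, y ∈ 𝔪 ^ e' • (⊤ : Submodule R (Fin b → R)) ∧
      vectorSymbol 𝔪 e' y = ψ' (Pi.single l 1) ∧ φ y = 0 := by
    obtain ⟨u, hu, hul⟩ := exists_vectorSymbol_eq 𝔪 (hψ' l)
    have h0 : φ u ∈ 𝔪 ^ (e' + 1 + e) • (⊤ : Submodule R N) := by
      rw [add_right_comm, ← hσ.eq_zero_iff (IsSymbol.map_mem h.map_single_mem hu),
        ← hσ.map_vectorSymbol h.map_single_mem h.map_single hu, hul]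
      exact (hex _).2 ⟨_, rfl⟩
    obtain ⟨u', hu', huu⟩ := h.strict h0
    have hu'' := Submodule.smul_mono_left (Ideal.pow_le_pow_right e'.le_succ) hu'
    refine ⟨u - u', sub_mem hu hu'', ?_, by rw [map_sub, huu, sub_self]⟩
    rw [hS.sub hu hu'', hul, (hS.eq_zero_iff hu'').2 hu', sub_zero]
  choose y hy hyψ hyφ using h1
  obtain ⟨φ', hφ'⟩ := exists_linearMap_single (A := R) y
  have hm (l) : φ' (Pi.single l 1) ∈ 𝔪 ^ e' • (⊤ : Submodule R (Fin b → R)) := by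
    rw [hφ']; exact hy l
  have hs (l) : ψ' (Pi.single l 1) = vectorSymbol 𝔪 e' (φ' (Pi.single l 1)) := by
    rw [hφ', hyψ]
  have hcomp (x) : φ (φ' x) = 0 := by
    rw [map_eq_sum_smul φ', map_sum]
    refine Finset.sum_eq_zero fun l _ => ?_
    rw [map_smul, hφ', hyφ, smul_zero]
  have hlift {n : ℕ} {x} (hx : φ x = 0) (hn : x ∈ 𝔪 ^ n • (⊤ : Submodule R (Fin b → R))) :
      ∃ z, ψ' z = vectorSymbol 𝔪 n x := by
    refine (hex _).1 ?_
    rw [hσ.map_vectorSymbol h.map_single_mem h.map_single hn, hx, hσ.zero]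
  have hall {n : ℕ} {x} (hx : φ x = 0) (hn : x ∈ 𝔪 ^ n • (⊤ : Submodule R (Fin b → R))) :
      ∃ u ∈ 𝔪 ^ (n - e') • (⊤ : Submodule R (Fin c → R)), φ' u = x := by
    refine exists_map_eq_of_symbol hS (LinearMap.ker φ) hcomp hm hs (fun n hn x hx hxn => ?_)
      (fun k x hx hxk => ?_) hx hn
    -- The entries of `ψ'` have degree `e' > n`, so no vector in its image has a nonzero part in
    -- degree `n`.
    · obtain ⟨z, hz⟩ := hlift hx hxn
      rw [← hS.eq_zero_iff hxn]
      ext j : 1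
      have hproj := (isGradedProjection_proj (AssocGradedRing.component 𝔪) n).1 _
        (AssocGradedRing.symbol_mem 𝔪 n (x j))
      change AssocGradedRing.symbol 𝔪 n (x j) = 0
      rw [← hproj]
      change GradedRing.proj _ n (vectorSymbol 𝔪 n x j) = 0
      rw [← hz, map_eq_sum_smul, Finset.sum_apply, map_sum]
      exact Finset.sum_eq_zero fun l _ =>
        coe_decompose_mul_of_right_mem_of_not_le _ (hψ' l j) (by omega)
    · obtain ⟨z, hz⟩ := hlift hx hxk
      -- As `ψ'` raises degrees by exactly `e'`, only the degree `k` part of `z` contributes in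
      -- degree `k + e'`.
      refine ⟨fun l => GradedRing.proj (AssocGradedRing.component 𝔪) k (z l),
        fun l => SetLike.coe_mem _, ?_⟩
      ext j : 1
      have hproj := (isGradedProjection_proj (AssocGradedRing.component 𝔪) (k + e')).1 _
        (AssocGradedRing.symbol_mem 𝔪 (k + e') (x j))
      change _ = AssocGradedRing.symbol 𝔪 (k + e') (x j)
      rw [← hproj]
      change _ = GradedRing.proj _ (k + e') (vectorSymbol 𝔪 (k + e') x j)
      rw [← hz, map_eq_sum_smul, map_eq_sum_smul ψ' z, Finset.sum_apply, Finset.sum_apply, map_sum]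
      exact Finset.sum_congr rfl fun l _ =>
        (coe_decompose_mul_add_of_right_mem _ (hψ' l j)).symm
  refine ⟨φ', ⟨hm, hs, fun {k u} hu => ?_⟩, hcomp, hall⟩
  obtain ⟨u', hu', h⟩ := hall (hcomp u) hu
  exact ⟨u', by rwa [Nat.add_sub_cancel] at hu', h⟩

/-! ### The augmentation and the lifted resolution. -/

variable {M : Type*} [AddCommGroup M] [Module R M]

/-- The projection of `G_I(M)` onto its homogeneous component of degree `n`. -/
def AssocGradedModule.proj {R : Type*} [CommRing R] (I : Ideal R) (M : Type*) [AddCommGroup M]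
    [Module R M] (n : ℕ) : AssocGradedModule I M →+ AssocGradedModule I M :=
  (AssocGradedModule.of I M n).comp (DFinsupp.evalAddMonoidHom (β := GrPiece I M) n)

theorem AssocGradedModule.isGradedProjection {R : Type*} [CommRing R] (I : Ideal R) (M : Type*)
    [AddCommGroup M] [Module R M] :
    IsGradedProjection (AssocGradedModule.component I M) (AssocGradedModule.proj I M) := by
  intro n
  constructor
  · rintro _ ⟨y, rfl⟩
    exact congrArg (AssocGradedModule.of I M n) (DirectSum.of_eq_same (β := GrPiece I M) n y)
  · rintro m hm _ ⟨y, rfl⟩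
    exact (congrArg (AssocGradedModule.of I M n)
      (DirectSum.of_eq_of_ne (β := GrPiece I M) m n y hm.symm)).trans (map_zero _)

/-- By purity all generators share one degree. If it is negative, they map to zero. If it is
positive, the graded module vanishes in degree 0, so `M = 𝔪 M`, all its graded pieces vanish, and
generators again map to zero. Both contradict minimality. -/
theorem deg_zero_eq_zero
    {G : MinimalGradedFreeResolution (AssocGradedRing.component 𝔪)
      (extendToInt (AssocGradedModule.component 𝔪 M))} (hG : G.IsPure) (l : Fin (G.rank 0)) :
    G.deg 0 l = 0 := by
  by_contra hd
  have haug := G.aug_graded _ _ (single_one_mem_gradedFreeComponent _ _ l)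
  suffices h0 : G.aug (Pi.single l 1) = 0 from
    single_one_notMem_smul_top (irrelevantIdeal_ne_top _) l (G.minimal_aug h0)
  rcases lt_or_gt_of_ne hd with hneg | hpos
  · rw [extendToInt_of_neg _ hneg] at haug
    exact haug
  have hM : (⊤ : Submodule R M) ≤ 𝔪 • ⊤ := by
    intro x _
    have hx : x ∈ 𝔪 ^ 0 • (⊤ : Submodule R M) := by simp
    have := (AssocGradedModule.isSymbol 𝔪 (M := M)).eq_zero_iff hx
    rw [zero_add, pow_one] at this
    rw [← this]
    obtain ⟨y, hy⟩ := G.aug_surjective (AssocGradedModule.symbol 𝔪 0 x)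
    have hπ := (AssocGradedModule.isGradedProjection 𝔪 M).extendToInt
    rw [← (hπ 0).1 _ (AssocGradedModule.symbol_mem 𝔪 0 x), ← hy,
      map_gradedFreeProj _ _ hπ G.aug_graded]
    convert map_zero G.aug
    ext j : 1
    have h := (mem_gradedFreeComponent_iff _ _).1
      (gradedFreeProj_mem (AssocGradedRing.component 𝔪) (G.deg 0) 0 y) j
    rw [G.isPure_iff.1 hG 0 j l, extendToInt_of_neg _ (by omega)] at h
    exact h
  have hpow (n : ℕ) : 𝔪 ^ n • (⊤ : Submodule R M) = ⊤ := by
    induction n with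
    | zero => simp
    | succ n ih => rw [pow_succ', mul_smul, ih]; exact top_le_iff.1 hM
  obtain ⟨n, hn⟩ := Int.eq_ofNat_of_zero_le hpos.le
  rw [hn] at haug
  obtain ⟨x, hx, hxe⟩ := AssocGradedModule.exists_symbol_eq 𝔪 haug
  rw [← hxe, (AssocGradedModule.isSymbol 𝔪).eq_zero_iff hx, hpow]
  trivial

theorem exists_strictLift_aug [IsNoetherianRing R] [Module.Finite R M]
    {G : MinimalGradedFreeResolution (AssocGradedRing.component 𝔪)
      (extendToInt (AssocGradedModule.component 𝔪 M))} (hG : G.IsPure) :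
    ∃ φ : (Fin (G.rank 0) → R) →ₗ[R] M, Function.Surjective φ ∧
      IsStrictLift (AssocGradedModule.symbol 𝔪) 0 φ G.aug := by
  have hσ := AssocGradedModule.isSymbol 𝔪 (M := M)
  have h1 (l) : ∃ x ∈ 𝔪 ^ 0 • (⊤ : Submodule R M),
      AssocGradedModule.symbol 𝔪 0 x = G.aug (Pi.single l 1) := by
    have := G.aug_graded _ _ (single_one_mem_gradedFreeComponent (AssocGradedRing.component 𝔪) _ l)
    rw [deg_zero_eq_zero hG] at this
    exact AssocGradedModule.exists_symbol_eq 𝔪 this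
  choose y hy hyG using h1
  obtain ⟨φ, hφ⟩ := exists_linearMap_single (A := R) y
  have hm (l) : φ (Pi.single l 1) ∈ 𝔪 ^ 0 • (⊤ : Submodule R M) := by
    rw [hφ]; exact hy l
  have hs (l) : G.aug (Pi.single l 1) = AssocGradedModule.symbol 𝔪 0 (φ (Pi.single l 1)) := by
    rw [hφ, hyG]
  have hall {n : ℕ} {x : M} (hn : x ∈ 𝔪 ^ n • (⊤ : Submodule R M)) :
      ∃ u ∈ 𝔪 ^ (n - 0) • (⊤ : Submodule R (Fin (G.rank 0) → R)), φ u = x := by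
    refine exists_map_eq_of_symbol hσ ⊤ (fun _ => trivial) hm hs
      (fun n hn => absurd hn n.not_lt_zero) (fun k x _ hxk => ?_) trivial hn
    obtain ⟨z, hz⟩ := G.aug_surjective (AssocGradedModule.symbol 𝔪 k x)
    refine ⟨gradedFreeProj (AssocGradedRing.component 𝔪) (G.deg 0) k z, fun l => ?_, ?_⟩
    · have := (mem_gradedFreeComponent_iff _ _).1
        (gradedFreeProj_mem (AssocGradedRing.component 𝔪) (G.deg 0) k z) l
      rwa [deg_zero_eq_zero hG, sub_zero] at this
    · have hπ := (AssocGradedModule.isGradedProjection 𝔪 M).extendToInt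
      rw [← map_gradedFreeProj _ _ hπ G.aug_graded, hz]
      exact (hπ k).1 _ (AssocGradedModule.symbol_mem 𝔪 k x)
  refine ⟨φ, fun x => ?_, hm, hs, fun {k u} hu => hall hu⟩
  obtain ⟨u, -, hu⟩ := hall (n := 0) (x := x) (by simp)
  exact ⟨u, hu⟩

theorem exact_of_forall_exists {a b : ℕ} {f : (Fin a → R) →ₗ[R] (Fin b → R)}
    {g : (Fin b → R) →ₗ[R] M} {k : ℕ} (hfg : ∀ x, g (f x) = 0)
    (h : ∀ {n : ℕ} {x}, g x = 0 → x ∈ 𝔪 ^ n • (⊤ : Submodule R (Fin b → R)) →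
      ∃ u ∈ 𝔪 ^ (n - k) • (⊤ : Submodule R (Fin a → R)), f u = x) : Function.Exact f g := by
  intro x
  constructor
  · intro hx
    obtain ⟨u, -, hu⟩ := h hx (mem_pow_zero_smul_top 𝔪 x)
    exact ⟨u, hu⟩
  · rintro ⟨u, rfl⟩
    exact hfg u

/-- A pure resolution of `G_𝔪(M)` lifts to a minimal free resolution of `M`. -/
theorem exists_lift_resolution [IsNoetherianRing R] [Module.Finite R M]
    {G : MinimalGradedFreeResolution (AssocGradedRing.component 𝔪)
      (extendToInt (AssocGradedModule.component 𝔪 M))} (hG : G.IsPure) {e : ℕ → ℕ}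
    (he1 : ∀ i, 1 ≤ e i) (he : ∀ i l j, G.deg (i + 1) l = G.deg i j + e i) :
    ∃ P : MinimalFreeResolution 𝔪 M, ∀ i u,
      P.d i u ∈ 𝔪 ^ (e i + 1) • (⊤ : Submodule R (Fin (P.rank i) → R)) →
        u ∈ 𝔪 • (⊤ : Submodule R (Fin (P.rank (i + 1)) → R)) := by
  have hdeg (i : ℕ) (l j) : G.d i (Pi.single l 1) j ∈ AssocGradedRing.component 𝔪 (e i) :=
    MinimalGradedFreeResolution.d_single_mem (he i l j)
  obtain ⟨φ, hφ, hφs⟩ := exists_strictLift_aug hG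
  let T (i : ℕ) : Type _ := {φ : (Fin (G.rank (i + 1)) → R) →ₗ[R] (Fin (G.rank i) → R) //
    IsStrictLift (vectorSymbol 𝔪) (e i) φ (G.d i)}
  obtain ⟨φ₁, h₁, hc₁, hl₁⟩ :=
    hφs.exists_next (AssocGradedModule.isSymbol 𝔪) (hdeg 0) G.exact_aug
  have step (i : ℕ) (α : T i) : ∃ β : T (i + 1), (∀ x, α.1 (β.1 x) = 0) ∧
      ∀ {n : ℕ} {x}, α.1 x = 0 → x ∈ 𝔪 ^ n • (⊤ : Submodule R (Fin (G.rank (i + 1)) → R)) →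
        ∃ u ∈ 𝔪 ^ (n - e (i + 1)) • (⊤ : Submodule R (Fin (G.rank (i + 2)) → R)), β.1 u = x := by
    obtain ⟨β, h, hh⟩ := α.2.exists_next (isSymbol_vectorSymbol 𝔪 _) (hdeg (i + 1)) (G.exact_d i)
    exact ⟨⟨β, h⟩, hh⟩
  choose next hcomp hlift using step
  let seq (i : ℕ) : T i := Nat.rec (motive := T) ⟨φ₁, h₁⟩ next i
  have hmem (i : ℕ) (u) : (seq i).1 u ∈ 𝔪 • (⊤ : Submodule R (Fin (G.rank i) → R)) := by
    have := IsSymbol.map_mem (seq i).2.map_single_mem (mem_pow_zero_smul_top 𝔪 u)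
    refine Submodule.smul_mono_left ?_ this
    exact Ideal.pow_le_self (by have := he1 i; omega)
  have hex0 : Function.Exact (seq 0).1 φ := exact_of_forall_exists hc₁ hl₁
  have hex (i : ℕ) : Function.Exact (seq (i + 1)).1 (seq i).1 :=
    exact_of_forall_exists (hcomp i (seq i)) (hlift i (seq i))
  refine ⟨⟨G.rank, φ, fun i => (seq i).1, hφ, hex0, hex, fun x hx => ?_, fun i x hx => ?_⟩,
    fun i u hu => ?_⟩
  · obtain ⟨u, rfl⟩ := (hex0 x).1 hx
    exact hmem 0 u
  · obtain ⟨u, rfl⟩ := (hex i x).1 hx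
    exact hmem (i + 1) u
  -- The degree 0 symbol of `u` is killed by `G.d i`, so by minimality its entries lie in `A_+`;
  -- being of degree 0 they vanish.
  · have hu0 : u ∈ 𝔪 ^ 0 • (⊤ : Submodule R (Fin (G.rank (i + 1)) → R)) :=
      mem_pow_zero_smul_top 𝔪 u
    have h := (isSymbol_vectorSymbol 𝔪 _).map_vectorSymbol (seq i).2.map_single_mem
      (seq i).2.map_single hu0
    have hmu := IsSymbol.map_mem (seq i).2.map_single_mem hu0
    rw [(isSymbol_vectorSymbol 𝔪 _).eq_zero_iff hmu |>.2 (by rwa [zero_add])] at h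
    have h2 := (mem_smul_top_pi_iff _ _).1 (G.minimal_d i h)
    have h3 : vectorSymbol 𝔪 0 u = 0 := by
      ext l : 1
      exact eq_zero_of_mem_irrelevantIdeal _ (h2 l) (AssocGradedRing.symbol_mem 𝔪 0 _)
    rwa [(isSymbol_vectorSymbol 𝔪 _).eq_zero_iff hu0, zero_add, pow_one] at h3

/-- The columns of a minimal free resolution have order `1` wherever the degrees of a pure
resolution of the associated graded module increase by `1`. -/
theorem adicOrder_d_single [IsNoetherianRing R] [Module.Finite R M]
    {G : MinimalGradedFreeResolution (AssocGradedRing.component 𝔪)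
      (extendToInt (AssocGradedModule.component 𝔪 M))} (hG : G.IsPure) {e : ℕ → ℕ}
    (he1 : ∀ i, 1 ≤ e i) (he : ∀ i l j, G.deg (i + 1) l = G.deg i j + e i)
    (F : MinimalFreeResolution 𝔪 M) {i : ℕ} (hi : e i = 1) (c : Fin (F.rank (i + 1))) :
    adicOrder 𝔪 (F.d i (Pi.single c 1)) = 1 := by
  refine adicOrder_eq_one (F.d_mem i _) fun h => ?_
  obtain ⟨P, hP⟩ := exists_lift_resolution hG he1 he
  obtain ⟨α⟩ := F.exists_comparison' P
  obtain ⟨β⟩ := P.exists_comparison' F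
  -- Were the column in `𝔪 ^ 2 = 𝔪 ^ (e i + 1)` times the free module, the image of the basis vector
  -- in `P` would vanish modulo `𝔪`, and so would the basis vector after mapping back.
  have h1 := hP i (α.map (i + 1) (Pi.single c 1)) (by
    rw [α.d_map, hi]
    exact map_mem_smul_top _ _ h)
  have h2 := sub_mem (map_mem_smul_top _ (β.map (i + 1)) h1)
    (α.comp_sub_mem β (i + 1) (Pi.single c 1))
  rw [sub_sub_cancel] at h2
  exact single_one_notMem_smul_top (maximalIdeal.isMaximal R).ne_top c h2

end Lifting

/-! ### Splitting of the irrelevant ideal -/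

section Splitting

variable {R : Type*} [CommRing R] (I 𝔞 𝔟 : Ideal R)

theorem AssocGradedRing.proj_smul_symbol {i : ℕ} {a : AssocGradedRing I}
    (ha : a ∈ AssocGradedRing.component I i) (z : AssocGradedRing I) (n : ℕ) :
    GradedRing.proj (component I) n (a * z) =
      if i ≤ n then a * GradedRing.proj (component I) (n - i) z else 0 :=
  coe_decompose_mul_of_left_mem _ n ha

/-- The initial ideal of `𝔞` in `G_I(R)`: its elements are those whose homogeneous components are
symbols of elements of `𝔞`. -/
def initialIdeal : Ideal (AssocGradedRing I) where
  carrier := {z | ∀ n, ∃ r ∈ I ^ n ⊓ 𝔞,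
    AssocGradedRing.symbol I n r = GradedRing.proj (AssocGradedRing.component I) n z}
  zero_mem' n := ⟨0, zero_mem _, by rw [(AssocGradedRing.isSymbol I).zero, map_zero]⟩
  add_mem' {y z} hy hz n := by
    obtain ⟨r, hr, hry⟩ := hy n
    obtain ⟨s, hs, hsz⟩ := hz n
    refine ⟨r + s, add_mem hr hs, ?_⟩
    rw [map_add, ← hry, ← hsz]
    exact (AssocGradedRing.isSymbol I).add ((mem_pow_smul_top_self I).2 hr.1)
      ((mem_pow_smul_top_self I).2 hs.1)
  smul_mem' a z hz := by
    have h0 (n : ℕ) : ∃ r ∈ I ^ n ⊓ 𝔞, AssocGradedRing.symbol I n r = 0 :=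
      ⟨0, zero_mem _, (AssocGradedRing.isSymbol I).zero n⟩
    induction a using DirectSum.Decomposition.inductionOn (AssocGradedRing.component I) with
    | zero => intro n; rw [zero_smul, map_zero]; exact h0 n
    | @homogeneous i a =>
      intro n
      rw [smul_eq_mul, AssocGradedRing.proj_smul_symbol I a.2]
      split_ifs with hi
      · obtain ⟨k, rfl⟩ := Nat.exists_eq_add_of_le hi
        obtain ⟨r, hr, hrz⟩ := hz k
        obtain ⟨s, hs, hsa⟩ := AssocGradedRing.exists_symbol_eq I a.2
        refine ⟨s * r, ⟨by rw [pow_add]; exact Ideal.mul_mem_mul hs hr.1,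
          𝔞.mul_mem_left s hr.2⟩, ?_⟩
        rw [Nat.add_sub_cancel_left, ← hrz, ← hsa]
        exact (AssocGradedRing.isSymbol I).smul hs ((mem_pow_smul_top_self I).2 hr.1)
      · exact h0 n
    | add a a' h h' =>
      intro n
      obtain ⟨r, hr, hry⟩ := h n
      obtain ⟨s, hs, hsz⟩ := h' n
      refine ⟨r + s, add_mem hr hs, ?_⟩
      rw [add_smul, map_add, ← hry, ← hsz]
      exact (AssocGradedRing.isSymbol I).add ((mem_pow_smul_top_self I).2 hr.1)
        ((mem_pow_smul_top_self I).2 hs.1)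

variable {I 𝔞 𝔟}

theorem symbol_mem_initialIdeal {n : ℕ} {r : R} (hr : r ∈ I ^ n ⊓ 𝔞) :
    AssocGradedRing.symbol I n r ∈ initialIdeal I 𝔞 := by
  intro m
  have h := isGradedProjection_proj (AssocGradedRing.component I) m
  rcases eq_or_ne n m with rfl | hn
  · exact ⟨r, hr, (h.1 _ (AssocGradedRing.symbol_mem I n r)).symm⟩
  · refine ⟨0, zero_mem _, ?_⟩
    rw [h.2 n hn _ (AssocGradedRing.symbol_mem I n r), (AssocGradedRing.isSymbol I).zero]

/-- Expand one factor: `I ^ (k + 1) = 𝔞 I ^ k + 𝔟 I ^ k`. -/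
theorem pow_le_sup_of_sup_eq (h : 𝔞 ⊔ 𝔟 = I) {n : ℕ} (hn : n ≠ 0) :
    I ^ n ≤ (I ^ n ⊓ 𝔞) ⊔ (I ^ n ⊓ 𝔟) := by
  obtain ⟨k, rfl⟩ := Nat.exists_eq_succ_of_ne_zero hn
  have ha : 𝔞 * I ^ k ≤ I ^ (k + 1) ⊓ 𝔞 :=
    le_inf (by rw [pow_succ']; exact Ideal.mul_mono_left (h ▸ le_sup_left)) Ideal.mul_le_left
  have hb : 𝔟 * I ^ k ≤ I ^ (k + 1) ⊓ 𝔟 :=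
    le_inf (by rw [pow_succ']; exact Ideal.mul_mono_left (h ▸ le_sup_right)) Ideal.mul_le_left
  calc I ^ (k + 1) = 𝔞 * I ^ k ⊔ 𝔟 * I ^ k := by rw [← Ideal.sup_mul, h, pow_succ']
    _ ≤ _ := sup_le_sup ha hb

/-- If `r ∈ 𝔞` and `s ∈ 𝔟` have the same symbol, then `r - s = a + b` with `a`, `b` in `I ^ (n + 1)`
and in `𝔞`, `𝔟`. So `r - a = s + b` lies in `𝔞 ∩ 𝔟 = 0`, and the symbol of `r = a` is zero. -/
theorem disjoint_initialIdeal (h : 𝔞 ⊔ 𝔟 = I) (hd : Disjoint 𝔞 𝔟) :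
    Disjoint (initialIdeal I 𝔞) (initialIdeal I 𝔟) := by
  rw [Submodule.disjoint_def]
  intro z hza hzb
  classical
  rw [← DirectSum.sum_support_decompose (AssocGradedRing.component I) z]
  refine Finset.sum_eq_zero fun n _ => ?_
  change GradedRing.proj (AssocGradedRing.component I) n z = 0
  obtain ⟨r, hr, hrz⟩ := hza n
  obtain ⟨s, hs, hsz⟩ := hzb n
  have hr' := (mem_pow_smul_top_self I).2 hr.1
  have hs' := (mem_pow_smul_top_self I).2 hs.1
  have hmem := (AssocGradedRing.isSymbol I).sub_mem_succ hr' hs' (hrz.trans hsz.symm)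
  rw [mem_pow_smul_top_self] at hmem
  obtain ⟨a, ha, b, hb, hab⟩ := Submodule.mem_sup.1 (pow_le_sup_of_sup_eq h n.succ_ne_zero hmem)
  have hra : r - a = 0 := by
    refine Submodule.disjoint_def.1 hd _ (sub_mem hr.2 ha.2) ?_
    have : r - a = s + b := by linear_combination -hab
    rw [this]
    exact add_mem hs.2 hb.2
  rw [← hrz, (AssocGradedRing.isSymbol I).eq_zero_iff hr', mem_pow_smul_top_self,
    sub_eq_zero.1 hra]
  exact ha.1

theorem irrelevantIdeal_le_initialIdeal_sup (h : 𝔞 ⊔ 𝔟 = I) :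
    irrelevantIdeal (AssocGradedRing.component I) ≤ initialIdeal I 𝔞 ⊔ initialIdeal I 𝔟 := by
  intro z hz
  classical
  rw [← DirectSum.sum_support_decompose (AssocGradedRing.component I) z]
  refine Ideal.sum_mem _ fun n _ => ?_
  rcases eq_or_ne n 0 with rfl | hn
  · have h0 : (decompose (AssocGradedRing.component I) z 0 : AssocGradedRing I) = 0 := hz
    rw [h0]
    exact zero_mem _
  · obtain ⟨r, hr, hrz⟩ := AssocGradedRing.exists_symbol_eq I
      (SetLike.coe_mem (decompose (AssocGradedRing.component I) z n))
    obtain ⟨a, ha, b, hb, rfl⟩ := Submodule.mem_sup.1 (pow_le_sup_of_sup_eq h hn hr)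
    rw [← hrz, (AssocGradedRing.isSymbol I).add ((mem_pow_smul_top_self I).2 ha.1)
      ((mem_pow_smul_top_self I).2 hb.1)]
    exact Submodule.add_mem_sup (symbol_mem_initialIdeal ha) (symbol_mem_initialIdeal hb)

/-- The symbol of any `r ∈ 𝔞` outside the square works: a nonzero form of degree 0 is the symbol of
a unit, and a unit multiple of `r` stays outside the square. -/
theorem exists_mem_initialIdeal_mul_ne_zero [IsLocalRing R] {𝔞 : Ideal R}
    (ha : 𝔞 ≤ maximalIdeal R) (h : ¬ 𝔞 ≤ maximalIdeal R ^ 2) :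
    ∃ b ∈ initialIdeal (maximalIdeal R) 𝔞, b ∈ AssocGradedRing.component (maximalIdeal R) 1 ∧
      ∀ c ∈ AssocGradedRing.component (maximalIdeal R) 0, b * c = 0 → c = 0 := by
  obtain ⟨r, hr, hr2⟩ := SetLike.not_le_iff_exists.1 h
  have hr1 : r ∈ maximalIdeal R ^ 1 := by rw [pow_one]; exact ha hr
  have hσ := AssocGradedRing.isSymbol (maximalIdeal R)
  refine ⟨AssocGradedRing.symbol _ 1 r, symbol_mem_initialIdeal ⟨hr1, hr⟩,
    AssocGradedRing.symbol_mem _ 1 r, fun c hc hbc => ?_⟩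
  obtain ⟨s, hs, rfl⟩ := AssocGradedRing.exists_symbol_eq _ hc
  have hs' := (mem_pow_smul_top_self (maximalIdeal R)).2 hs
  have hrs : r • s ∈ maximalIdeal R ^ (1 + 0) • (⊤ : Submodule R R) :=
    GrPiece.smul_mem ((mem_pow_smul_top_self _).2 hr1) hs'
  rw [← smul_eq_mul, ← hσ.smul hr1 hs', hσ.eq_zero_iff hrs, mem_pow_smul_top_self] at hbc
  rw [hσ.eq_zero_iff hs', mem_pow_smul_top_self, zero_add, pow_one, mem_maximalIdeal]
  intro hu
  exact hr2 ((Ideal.unit_mul_mem_iff_mem _ hu).1 (by rwa [mul_comm]))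

theorem irrelevantIdealSplits_of_maximalIdeal [IsLocalRing R] {𝔞 𝔟 : Ideal R}
    (h : 𝔞 ⊔ 𝔟 = maximalIdeal R) (hd : Disjoint 𝔞 𝔟) (ha : ¬ 𝔞 ≤ maximalIdeal R ^ 2)
    (hb : ¬ 𝔟 ≤ maximalIdeal R ^ 2) :
    IrrelevantIdealSplits (AssocGradedRing.component (maximalIdeal R))
      (initialIdeal (maximalIdeal R) 𝔞) (initialIdeal (maximalIdeal R) 𝔟) where
  le_sup := irrelevantIdeal_le_initialIdeal_sup h
  disjoint := disjoint_initialIdeal h hd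
  left := exists_mem_initialIdeal_mul_ne_zero (h ▸ le_sup_left) ha
  right := exists_mem_initialIdeal_mul_ne_zero (h ▸ le_sup_right) hb

end Splitting

/-! ### Fibre products -/

/-- Nakayama's lemma. -/
theorem exists_mem_maximalIdeal_notMem_sq {S : Type*} [CommRing S] [IsLocalRing S]
    [IsNoetherianRing S] (h : ¬ IsField S) :
    ∃ x ∈ maximalIdeal S, x ∉ maximalIdeal S ^ 2 := by
  by_contra! hle
  refine h (isField_iff_maximalIdeal_eq.2 ?_)
  refine Submodule.eq_bot_of_le_smul_of_le_jacobson_bot (maximalIdeal S) _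
    (IsNoetherian.noetherian _) ?_ (maximalIdeal_le_jacobson _)
  intro x hx
  rw [smul_eq_mul, ← sq]
  exact hle x hx

namespace fibreProduct

variable {R₁ R₂ k : Type*} [CommRing R₁] [IsLocalRing R₁] [CommRing R₂] [IsLocalRing R₂] [Field k]
  (ι₁ : ResidueField R₁ ≃+* k) (ι₂ : ResidueField R₂ ≃+* k)

theorem mem_iff {x : R₁ × R₂} :
    x ∈ fibreProduct ι₁ ι₂ ↔ ι₁ (residue R₁ x.1) = ι₂ (residue R₂ x.2) := Iff.rfl

/-- The first projection. -/
def fst : fibreProduct ι₁ ι₂ →+* R₁ := (RingHom.fst R₁ R₂).comp (fibreProduct ι₁ ι₂).subtype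

/-- The second projection. -/
def snd : fibreProduct ι₁ ι₂ →+* R₂ := (RingHom.snd R₁ R₂).comp (fibreProduct ι₁ ι₂).subtype

theorem fst_surjective : Function.Surjective (fst ι₁ ι₂) := by
  intro a
  obtain ⟨b, hb⟩ := residue_surjective (ι₂.symm (ι₁ (residue R₁ a)))
  exact ⟨⟨(a, b), by rw [mem_iff, hb, RingEquiv.apply_symm_apply]⟩, rfl⟩

theorem snd_surjective : Function.Surjective (snd ι₁ ι₂) := by
  intro b
  obtain ⟨a, ha⟩ := residue_surjective (ι₁.symm (ι₂ (residue R₂ b)))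
  exact ⟨⟨(a, b), by rw [mem_iff, ha, RingEquiv.apply_symm_apply]⟩, rfl⟩

/-- Both factors are Noetherian over the fibre product because the projections are surjective, and
the fibre product is a submodule of their product. -/
theorem isNoetherianRing [IsNoetherianRing R₁] [IsNoetherianRing R₂] :
    IsNoetherianRing (fibreProduct ι₁ ι₂) := by
  let := Module.compHom R₁ (fst ι₁ ι₂)
  let := Module.compHom R₂ (snd ι₁ ι₂)
  have : RingHomSurjective (fst ι₁ ι₂) := ⟨fst_surjective ι₁ ι₂⟩
  have : RingHomSurjective (snd ι₁ ι₂) := ⟨snd_surjective ι₁ ι₂⟩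
  let f₁ : R₁ →ₛₗ[fst ι₁ ι₂] R₁ :=
    { toFun := id, map_add' := fun _ _ => rfl, map_smul' := fun _ _ => rfl }
  let f₂ : R₂ →ₛₗ[snd ι₁ ι₂] R₂ :=
    { toFun := id, map_add' := fun _ _ => rfl, map_smul' := fun _ _ => rfl }
  have : IsNoetherian (fibreProduct ι₁ ι₂) R₁ :=
    (LinearMap.isNoetherian_iff_of_bijective f₁ Function.bijective_id).2 ‹_›
  have : IsNoetherian (fibreProduct ι₁ ι₂) R₂ :=
    (LinearMap.isNoetherian_iff_of_bijective f₂ Function.bijective_id).2 ‹_›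
  let g : fibreProduct ι₁ ι₂ →ₗ[fibreProduct ι₁ ι₂] R₁ × R₂ :=
    { toFun := Subtype.val, map_add' := fun _ _ => rfl, map_smul' := fun _ _ => rfl }
  exact isNoetherian_of_injective g Subtype.val_injective

theorem mem_maximalIdeal_iff_fst {x : fibreProduct ι₁ ι₂} :
    x ∈ maximalIdeal (fibreProduct ι₁ ι₂) ↔ x.1.1 ∈ maximalIdeal R₁ := by
  have h : (maximalIdeal R₁).comap (fst ι₁ ι₂) = maximalIdeal (fibreProduct ι₁ ι₂) :=
    eq_maximalIdeal (Ideal.comap_isMaximal_of_surjective _ (fst_surjective ι₁ ι₂))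
  rw [← h]
  rfl

theorem mem_maximalIdeal_iff_snd {x : fibreProduct ι₁ ι₂} :
    x ∈ maximalIdeal (fibreProduct ι₁ ι₂) ↔ x.1.2 ∈ maximalIdeal R₂ := by
  have h : (maximalIdeal R₂).comap (snd ι₁ ι₂) = maximalIdeal (fibreProduct ι₁ ι₂) :=
    eq_maximalIdeal (Ideal.comap_isMaximal_of_surjective _ (snd_surjective ι₁ ι₂))
  rw [← h]
  rfl

/-- Write `(a, b) = (a, 0) + (0, b)`; the summands belong to the fibre product once the residues are
zero. -/
theorem sup_ker_eq_maximalIdeal :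
    RingHom.ker (snd ι₁ ι₂) ⊔ RingHom.ker (fst ι₁ ι₂) = maximalIdeal (fibreProduct ι₁ ι₂) := by
  refine le_antisymm (sup_le (fun x hx => ?_) fun x hx => ?_) fun x hx => ?_
  · rw [mem_maximalIdeal_iff_snd]
    have : x.1.2 = 0 := hx
    rw [this]
    exact zero_mem _
  · rw [mem_maximalIdeal_iff_fst]
    have : x.1.1 = 0 := hx
    rw [this]
    exact zero_mem _
  · have h₁ := (residue_eq_zero_iff _).2 ((mem_maximalIdeal_iff_fst ι₁ ι₂).1 hx)
    have h₂ := (residue_eq_zero_iff _).2 ((mem_maximalIdeal_iff_snd ι₁ ι₂).1 hx)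
    refine Submodule.mem_sup.2 ⟨⟨(x.1.1, 0), ?_⟩, rfl, ⟨(0, x.1.2), ?_⟩, rfl, ?_⟩
    · rw [mem_iff, h₁, map_zero, map_zero, map_zero]
    · rw [mem_iff, h₂, map_zero, map_zero, map_zero]
    · exact Subtype.ext (Prod.ext (add_zero _) (zero_add _))

theorem disjoint_ker : Disjoint (RingHom.ker (snd ι₁ ι₂)) (RingHom.ker (fst ι₁ ι₂)) :=
  Submodule.disjoint_def.2 fun _ h₂ h₁ => Subtype.ext (Prod.ext h₁ h₂)

theorem ker_snd_not_le_sq [IsNoetherianRing R₁] (h : ¬ IsField R₁) :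
    ¬ RingHom.ker (snd ι₁ ι₂) ≤ maximalIdeal (fibreProduct ι₁ ι₂) ^ 2 := by
  obtain ⟨a, ha, ha2⟩ := exists_mem_maximalIdeal_notMem_sq h
  intro hle
  have hmem : (⟨(a, 0), by
    rw [mem_iff, (residue_eq_zero_iff _).2 ha, map_zero, map_zero, map_zero]⟩ :
      fibreProduct ι₁ ι₂) ∈ RingHom.ker (snd ι₁ ι₂) := rfl
  have h1 : (maximalIdeal (fibreProduct ι₁ ι₂)).map (fst ι₁ ι₂) ≤ maximalIdeal R₁ :=
    Ideal.map_le_iff_le_comap.2 fun x hx => (mem_maximalIdeal_iff_fst ι₁ ι₂).1 hx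
  have h2 := Ideal.mem_map_of_mem (fst ι₁ ι₂) (hle hmem)
  rw [Ideal.map_pow] at h2
  exact ha2 (Ideal.pow_right_mono h1 2 h2)

theorem ker_fst_not_le_sq [IsNoetherianRing R₂] (h : ¬ IsField R₂) :
    ¬ RingHom.ker (fst ι₁ ι₂) ≤ maximalIdeal (fibreProduct ι₁ ι₂) ^ 2 := by
  obtain ⟨b, hb, hb2⟩ := exists_mem_maximalIdeal_notMem_sq h
  intro hle
  have hmem : (⟨(0, b), by
    rw [mem_iff, (residue_eq_zero_iff _).2 hb, map_zero, map_zero, map_zero]⟩ :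
      fibreProduct ι₁ ι₂) ∈ RingHom.ker (fst ι₁ ι₂) := rfl
  have h1 : (maximalIdeal (fibreProduct ι₁ ι₂)).map (snd ι₁ ι₂) ≤ maximalIdeal R₂ :=
    Ideal.map_le_iff_le_comap.2 fun x hx => (mem_maximalIdeal_iff_snd ι₁ ι₂).1 hx
  have h2 := Ideal.mem_map_of_mem (snd ι₁ ι₂) (hle hmem)
  rw [Ideal.map_pow] at h2
  exact hb2 (Ideal.pow_right_mono h1 2 h2)

theorem irrelevantIdealSplits [IsNoetherianRing R₁] [IsNoetherianRing R₂] (h₁ : ¬ IsField R₁)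
    (h₂ : ¬ IsField R₂) :
    IrrelevantIdealSplits (AssocGradedRing.component (maximalIdeal (fibreProduct ι₁ ι₂)))
      (initialIdeal _ (RingHom.ker (snd ι₁ ι₂))) (initialIdeal _ (RingHom.ker (fst ι₁ ι₂))) :=
  irrelevantIdealSplits_of_maximalIdeal (sup_ker_eq_maximalIdeal ι₁ ι₂) (disjoint_ker ι₁ ι₂)
    (ker_snd_not_le_sq ι₁ ι₂ h₁) (ker_fst_not_le_sq ι₁ ι₂ h₂)

end fibreProduct
end

/-! ### The main theorem. -/

theorem corollary4p8 {R₁ R₂ k : Type*} [CommRing R₁] [IsLocalRing R₁] [CommRing R₂]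
    [IsLocalRing R₂] [Field k] (ι₁ : ResidueField R₁ ≃+* k) (ι₂ : ResidueField R₂ ≃+* k)
    (hR₁ : IsKoszulLocalRing R₁) (hR₂ : IsKoszulLocalRing R₂)
    (hk₁ : ¬ IsField R₁) (hk₂ : ¬ IsField R₂)
    (M : Type*) [AddCommGroup M] [Module (fibreProduct ι₁ ι₂) M]
    [Module.Finite (fibreProduct ι₁ ι₂) M]
    (hM : HasPureResolution (AssocGradedRing.component (maximalIdeal (fibreProduct ι₁ ι₂)))
      (extendToInt (AssocGradedModule.component (maximalIdeal (fibreProduct ι₁ ι₂)) M))) :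
    -- for every minimal graded free resolution of `G_𝔪(M)` over `A = G_𝔪(R)`, the second syzygy
    -- module `Ω_2` (a submodule of the first free module) has a linear resolution
    (∀ G : MinimalGradedFreeResolution
        (AssocGradedRing.component (maximalIdeal (fibreProduct ι₁ ι₂)))
        (extendToInt (AssocGradedModule.component (maximalIdeal (fibreProduct ι₁ ι₂)) M)),
      HasLinearResolution (AssocGradedRing.component (maximalIdeal (fibreProduct ι₁ ι₂)))
        (G.syzygySuccComponent 1)) ∧
    -- for every minimal free resolution of `M` over `R` and every `j = i + 1 > 2`, each column
    -- of the matrix of `φ_j = F.d i` has order `1`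
    (∀ F : MinimalFreeResolution (maximalIdeal (fibreProduct ι₁ ι₂)) M,
      ∀ i : ℕ, 2 < i + 1 → ∀ c : Fin (F.rank (i + 1)),
        adicOrder (maximalIdeal (fibreProduct ι₁ ι₂)) (F.d i (Pi.single c 1)) = 1) := by
  have := hR₁.1
  have := hR₂.1
  have := fibreProduct.isNoetherianRing ι₁ ι₂
  have hs := fibreProduct.irrelevantIdealSplits ι₁ ι₂ hk₁ hk₂
  obtain ⟨G, hG⟩ := hM
  refine ⟨fun G' => ?_, fun F i hi c => ?_⟩
  -- Purity is given for one resolution and is needed for an arbitrary one.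
  · have hG' := MinimalGradedFreeResolution.IsPure.of_isPure
      (AssocGradedModule.isGradedProjection _ M).extendToInt hG G'
    exact hG'.hasLinearResolution_syzygySucc_one hs
  · obtain ⟨e, he⟩ := hG.exists_shift_eventually_one hs
    -- The first index is `i = 2`, that is `φ_3 : F_3 → F_2`, exactly where the shifts become 1.
    obtain ⟨j, rfl⟩ := Nat.exists_eq_add_of_le' (Nat.lt_succ_iff.1 hi)
    exact adicOrder_d_single hG (fun i => (he i).1) (fun i => (he i).2.1) F (he j).2.2 c
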